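/- Let $n\ge 1$, let $P_{Y}=\mathcal N(0,I_n)$ be the standard Gaussian law on $\mathbb R^n$, and let $P_{Z}$ be a Borel probability measure on $\mathbb R^n$ with $\mathbb E[\|Z\|^2]<\infty$ and $P_{Z}\ll P_{Y}$. For a coupling $P$ of $P_Z$ and $P_Y$ (a probability measure on $\mathbb R^n\times\mathbb R^n$ with these marginals) let $i_P(z;y)=\ln\frac{dP}{d(P_Z\otimes P_Y)}(z,y)$ be the information density and $I_P(Z;Y)=\mathbb E_P[i_P(Z;Y)]\in[0,\infty]$ the mutual information (equal to $\infty$ if $P\not\ll P_Z\otimes P_Y$). For $R,\tau\ge 0$ and $\delta\in(0,\infty]$ let $$W_2(P_Z,P_Y;R,\tau,\delta)=\inf_P\left(\mathbb E_P[\|Z-Y\|^2]\right)^{1/2},$$ where $\|\cdot\|$ is the Euclidean norm and the infimum is over all couplings $P$ of $P_Z$ and $P_Y$ such that $$I_P(Z;Y)\le R\quad\text{and}\quad P\big(|i_P(Z;Y)-I_P(Z;Y)|\le\tau\big)\ge 1-\delta.$$ Let $h(Z)=-\int f\ln f\in[-\infty,\infty)$ be the differential entropy of $Z$, where $f$ is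 the Lebesgue density of $P_Z$, with the convention $e^{-\infty}=0$. Then for all real $R,\tau\ge 0$, $$W_2^2\big(P_{Z},P_{Y};R,\tau,6n/\tau^2\big)\;\le\;\mathbb E[\|Z\|^2]+n-2n\sqrt{\frac{1}{2\pi e}\,e^{\frac{2}{n}h(Z)}\left(1-e^{-\frac{2R}{n}}\right)},$$ where $6n/\tau^2$ is read as $\infty$ (so that the probability constraint is void) when $\tau=0$. -/

import Mathlib

open MeasureTheory ProbabilityTheory
open scoped ENNReal NNReal

noncomputable section

namespace InfoOT

/-- The set of couplings of `μ` and `ν`: measures on the product with marginals `μ` and `ν`. -/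
def couplings {X Y : Type*} [MeasurableSpace X] [MeasurableSpace Y]
    (μ : Measure X) (ν : Measure Y) : Set (Measure (X × Y)) :=
  {P | P.fst = μ ∧ P.snd = ν}

/-- Information density `i_P(z;y) = ln (dP / d(P_Z ⊗ P_Y)) (z, y)` of a joint law `P` of `(Z, Y)`.
It is meaningful when `P ≪ P_Z ⊗ P_Y`. -/
def infoDensity {X Y : Type*} [MeasurableSpace X] [MeasurableSpace Y]
    (P : Measure (X × Y)) (w : X × Y) : ℝ :=
  Real.log (P.rnDeriv (P.fst.prod P.snd) w).toReal

/-- Mutual information `I_P(Z;Y) = D(P ‖ P_Z ⊗ P_Y)`, with values in `[0, ∞]`. For a probability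
measure `P` it is `E_P[i_P(Z;Y)]` when `P ≪ P_Z ⊗ P_Y` and the information density is
`P`-integrable, and it is `∞` otherwise. -/
def mutualInfo {X Y : Type*} [MeasurableSpace X] [MeasurableSpace Y]
    (P : Measure (X × Y)) : ℝ≥0∞ :=
  InformationTheory.klDiv P (P.fst.prod P.snd)

/-- The `(R, τ, δ)`-information density constraint: `I_P(Z;Y) ≤ R`, and
`P (|i_P(Z;Y) - I_P(Z;Y)| ≤ τ) ≥ 1 - δ`. For `δ ≥ 1` (in particular `δ = ∞`) the second
condition is void. The first condition makes the mutual information finite, so that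
`toReal` is harmless. -/
def InfoDensityConstraint {X Y : Type*} [MeasurableSpace X] [MeasurableSpace Y]
    (P : Measure (X × Y)) (R τ : ℝ≥0) (δ : ℝ≥0∞) : Prop :=
  mutualInfo P ≤ R ∧
    1 - δ ≤ P {w | |infoDensity P w - (mutualInfo P).toReal| ≤ τ}

/-- The Wasserstein distance of order `p` between `μ` and `ν` subject to the `(R, τ, δ)`-information
density constraint, with values in `[0, ∞]`. -/
def infoDensityWasserstein {Ω : Type*} [PseudoEMetricSpace Ω] [MeasurableSpace Ω]
    (p : ℝ) (μ ν : Measure Ω) (R τ : ℝ≥0) (δ : ℝ≥0∞) : ℝ≥0∞ :=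
  ⨅ P ∈ {P ∈ couplings μ ν | InfoDensityConstraint P R τ δ},
    (∫⁻ w, edist w.1 w.2 ^ p ∂P) ^ (1 / p)

/-- Differential entropy `h(μ) = - ∫ f ln f` of a law `μ` with Lebesgue density `f`, with values in
`[-∞, ∞]`: the integral of the positive part of `- f ln f` minus that of its negative part. For a
probability measure with finite second moment on a Euclidean space the former is finite, so the
difference is never `∞ - ∞`; the value `-∞` does occur. -/
def differentialEntropy {E : Type*} [MeasureSpace E] (μ : Measure E) : EReal :=
  ((∫⁻ x, ENNReal.ofReal (Real.negMulLog (μ.rnDeriv volume x).toReal) : ℝ≥0∞) : EReal) -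
    ((∫⁻ x, ENNReal.ofReal (-Real.negMulLog (μ.rnDeriv volume x).toReal) : ℝ≥0∞) : EReal)

end InfoOT

end

/-!
The coupling comes from a Gaussian channel. A measurable map `S` sends the law of `Z` to the
standard Gaussian law; with `U = S(Z)` and an independent standard Gaussian `W` put
`Y = r U + s W`, where `s = e^{-R/n}` and `r² + s² = 1`. Then `Y` is standard Gaussian. Because `Z`
enters the channel only through `U`, the joint law has the channel density at `S(z)`
(`gaussCoupling_eq_withDensity`), whether or not `S` is invertible. Hence the mutual
information is `-n log s = R`, and the information density minus its mean is `(‖Y‖² - ‖W‖²) / 2`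
(`mutualInfo_gaussCoupling`, `ae_log_rnDeriv_gaussCoupling`). Its variance is at most that of
`‖W‖²`, which is at most `n E[w⁴] ≤ 6 n`, and Chebyshev's inequality gives the probability
constraint (`infoDensityConstraint_gaussCoupling`). The cost is `E‖Z‖² + n - 2 r E⟨Z, U⟩`, so it
remains to choose `S` with `E⟨Z, U⟩ ≥ n √(e^{2h(Z)/n} / (2πe))` (`exists_map_correlation_ge`).

For `S` one takes the Knothe–Rosenblatt map, built one coordinate at a time from conditional
distribution functions. On the line `U = Φ⁻¹(F(Z))` satisfies `E[U 1{Z > z}] = φ(Φ⁻¹(F(z)))`, and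
integration over `z` gives `E[Z U] = ∫ φ(Φ⁻¹(F(z))) dz ≥ E[φ(U) / g(Z)]` for the density `g` of `Z`
(`lintegral_gaussianPDFReal_div_le`); no differentiability of the map is needed. In `n` dimensions
the factors `aᵢ = φ(Uᵢ) / g(Zᵢ | other coordinates already treated)` multiply to the ratio of the
Gaussian density at `U` and the density `f` of `Z` (`exists_triangular_gaussian_map`). Jensen's
inequality and the inequality of arithmetic and geometric means then turn `E[∑ log aᵢ]`, which is
`h(Z)` minus the Gaussian entropy, into the lower bound for `E⟨Z, U⟩ ≥ ∑ E[aᵢ]`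
(`integral_sum_log_le`).
-/

section

open Set Filter Topology

/-! ### The standard normal distribution function and its inverse -/

theorem continuous_cdf_of_nullSingleton (m : Measure ℝ) [IsProbabilityMeasure m]
    [NullSingletonClass m] : Continuous (cdf m) := by
  rw [continuous_iff_continuousAt]
  intro x
  rw [(monotone_cdf m).continuousAt_iff_leftLim_eq_rightLim, StieltjesFunction.rightLim_eq]
  have h := (cdf m).measure_singleton x
  rw [measure_cdf] at h
  rw [measure_singleton] at h
  have h2 := ENNReal.ofReal_eq_zero.1 h.symm
  exact le_antisymm ((monotone_cdf m).leftLim_le le_rfl) (by linarith)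

instance nullSingletonClass_stdGaussianReal : NullSingletonClass (gaussianReal 0 1) :=
  nullSingletonClass_gaussianReal one_ne_zero

theorem strictMono_cdf_gaussianReal : StrictMono (cdf (gaussianReal 0 1)) := by
  intro a b hab
  refine lt_of_le_of_ne (monotone_cdf _ hab.le) fun h => ?_
  have h1 : (gaussianReal 0 1) (Ioc a b) = 0 := by
    rw [← measure_cdf (gaussianReal 0 1), StieltjesFunction.measure_Ioc, h]
    simp
  have h2 := gaussianReal_absolutelyContinuous' 0 one_ne_zero h1
  rw [Real.volume_Ioc, ENNReal.ofReal_eq_zero] at h2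
  linarith

theorem exists_cdf_gaussianReal_eq {p : ℝ} (hp : p ∈ Ioo (0 : ℝ) 1) :
    ∃ t, cdf (gaussianReal 0 1) t = p :=
  mem_range_of_exists_le_of_exists_ge (continuous_cdf_of_nullSingleton _)
    (((tendsto_cdf_atBot _).eventually_le_const hp.1).exists)
    (((tendsto_cdf_atTop _).eventually_const_le hp.2).exists)

theorem exists_measurable_leftInverse_cdf_gaussianReal :
    ∃ q : ℝ → ℝ, Measurable q ∧ q ∘ cdf (gaussianReal 0 1) = id :=
  ((continuous_cdf_of_nullSingleton _).measurableEmbedding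
    strictMono_cdf_gaussianReal.injective).exists_measurable_extend measurable_id
    fun _ => inferInstance

/-- The standard normal quantile function: a measurable inverse of the distribution function
on `(0, 1)`; its values elsewhere are irrelevant. -/
noncomputable def gaussQuantile : ℝ → ℝ :=
  exists_measurable_leftInverse_cdf_gaussianReal.choose

theorem measurable_gaussQuantile : Measurable gaussQuantile :=
  exists_measurable_leftInverse_cdf_gaussianReal.choose_spec.1

theorem gaussQuantile_cdf (t : ℝ) : gaussQuantile (cdf (gaussianReal 0 1) t) = t :=
  congrFun exists_measurable_leftInverse_cdf_gaussianReal.choose_spec.2 t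

theorem cdf_gaussQuantile {p : ℝ} (hp : p ∈ Ioo (0 : ℝ) 1) :
    cdf (gaussianReal 0 1) (gaussQuantile p) = p := by
  obtain ⟨t, rfl⟩ := exists_cdf_gaussianReal_eq hp
  rw [gaussQuantile_cdf]

theorem gaussQuantile_le_iff {p t : ℝ} (hp : p ∈ Ioo (0 : ℝ) 1) :
    gaussQuantile p ≤ t ↔ p ≤ cdf (gaussianReal 0 1) t := by
  rw [← strictMono_cdf_gaussianReal.le_iff_le, cdf_gaussQuantile hp]

theorem cdf_gaussianReal_mem_Ioo (t : ℝ) : cdf (gaussianReal 0 1) t ∈ Ioo (0 : ℝ) 1 :=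
  ⟨(cdf_nonneg _ (t - 1)).trans_lt (strictMono_cdf_gaussianReal (by linarith)),
    (strictMono_cdf_gaussianReal (by linarith)).trans_le (cdf_le_one _ (t + 1))⟩

/-- The tail mean of the standard normal law is its density: `∫_a^∞ v φ(v) dv = φ(a)`. -/
theorem setIntegral_Ioi_gaussianReal (a : ℝ) :
    ∫ v in Ioi a, v ∂(gaussianReal 0 1) = gaussianPDFReal 0 1 a := by
  have hint : Integrable (fun v : ℝ => gaussianPDFReal 0 1 v * v) := by
    have h : Integrable (fun v : ℝ => v) (gaussianReal 0 1) :=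
      (memLp_id_gaussianReal' 1 (by simp)).integrable le_rfl
    rw [gaussianReal_of_var_ne_zero 0 one_ne_zero,
      integrable_withDensity_iff_integrable_smul' (measurable_gaussianPDF 0 1)
        (by simp [gaussianPDF_lt_top])] at h
    simpa using h
  -- `-φ` is a primitive of `v φ(v)`
  have hder : ∀ x : ℝ, HasDerivAt (fun v => -gaussianPDFReal 0 1 v)
      (gaussianPDFReal 0 1 x * x) x := by
    intro x
    have h1 : HasDerivAt (fun v : ℝ => -(v ^ 2) / 2) (-x) x := by
      have := ((hasDerivAt_pow 2 x).neg).div_const 2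
      exact this.congr_deriv (by simp; ring)
    have h2 := (h1.exp.const_mul (√(2 * Real.pi))⁻¹).neg
    have e1 : (fun v => -gaussianPDFReal 0 1 v) =
        -fun y => (√(2 * Real.pi))⁻¹ * Real.exp (-y ^ 2 / 2) := by
      ext v; simp [gaussianPDFReal]
    have e2 : gaussianPDFReal 0 1 x * x =
        -((√(2 * Real.pi))⁻¹ * (Real.exp (-x ^ 2 / 2) * -x)) := by
      simp only [gaussianPDFReal, NNReal.coe_one, sub_zero, mul_one]; ring
    rw [e1, e2]
    exact h2
  have hlim : Tendsto (fun v => -gaussianPDFReal 0 1 v) atTop (𝓝 0) := by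
    have h1 : Tendsto (fun v : ℝ => -(v ^ 2 / 2)) atTop atBot :=
      tendsto_neg_atTop_atBot.comp
        ((tendsto_pow_atTop two_ne_zero).atTop_div_const two_pos)
    have h2 := ((Real.tendsto_exp_atBot.comp h1).const_mul (√(2 * Real.pi))⁻¹).neg
    simp only [mul_zero, neg_zero] at h2
    convert h2 using 1
    ext v; simp [gaussianPDFReal, neg_div]
  have h := integral_Ioi_of_hasDerivAt_of_tendsto (a := a)
    (hder a).continuousAt.continuousWithinAt (fun x _ => hder x) hint.integrableOn hlim
  rw [gaussianReal_of_var_ne_zero 0 one_ne_zero, restrict_withDensity measurableSet_Ioi,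
    integral_withDensity_eq_integral_toReal_smul (measurable_gaussianPDF 0 1)
      (by simp [gaussianPDF_lt_top])]
  simpa using h

/-! ### The monotone map of a law on the line to the standard normal law -/

theorem measurable_gaussQuantile_cdf (m : Measure ℝ) :
    Measurable fun z => gaussQuantile (cdf m z) :=
  measurable_gaussQuantile.comp (monotone_cdf m).measurable

section OneDim

variable (m : Measure ℝ) [IsProbabilityMeasure m] [NullSingletonClass m]

/-- The distribution function of an atomless law is uniformly distributed under it. -/
theorem measure_cdf_le {p : ℝ} (hp : p ∈ Ioo (0 : ℝ) 1) :
    m {z | cdf m z ≤ p} = ENNReal.ofReal p := by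
  have hc := continuous_cdf_of_nullSingleton m
  have hcl : IsClosed {z | cdf m z ≤ p} := isClosed_le hc continuous_const
  have hne : {z | cdf m z ≤ p}.Nonempty :=
    ((tendsto_cdf_atBot m).eventually_le_const hp.1).exists
  obtain ⟨b, hb⟩ := ((tendsto_cdf_atTop m).eventually_const_lt hp.2).exists
  have hbdd : BddAbove {z | cdf m z ≤ p} := ⟨b, fun z hz => by
    by_contra h
    exact absurd (monotone_cdf m (not_le.1 h).le) (not_le.2 (lt_of_le_of_lt hz hb))⟩
  -- the sublevel set is a closed half-line, and `F` equals `p` at its end point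
  set z₀ := sSup {z | cdf m z ≤ p}
  have hz₀ : cdf m z₀ ≤ p := hcl.csSup_mem hne hbdd
  have hset : {z | cdf m z ≤ p} = Iic z₀ := by
    ext z
    exact ⟨fun hz => le_csSup hbdd hz, fun hz => (monotone_cdf m hz).trans hz₀⟩
  have hge : p ≤ cdf m z₀ := by
    refine ge_of_tendsto (hc.continuousAt.tendsto.mono_left (nhdsWithin_le_nhds (s := Ioi z₀))) ?_
    filter_upwards [self_mem_nhdsWithin] with z hz
    by_contra h
    exact absurd (le_csSup hbdd (not_le.1 h).le) (not_le.2 hz)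
  rw [hset, ← ofReal_cdf, le_antisymm hz₀ hge]

theorem ae_cdf_mem_Ioo : ∀ᵐ z ∂m, cdf m z ∈ Ioo (0 : ℝ) 1 := by
  have h0 : ∀ᵐ z ∂m, 0 < cdf m z := by
    simp only [ae_iff, not_lt]
    refine le_antisymm (ge_of_tendsto (x := 𝓝[>] (0 : ℝ)) (f := fun p => ENNReal.ofReal p) ?_ ?_)
      zero_le
    · have := (ENNReal.continuous_ofReal.tendsto (0 : ℝ)).mono_left
        (nhdsWithin_le_nhds (s := Ioi (0 : ℝ)))
      simpa using this
    · filter_upwards [Ioo_mem_nhdsGT (zero_lt_one' ℝ)] with p hp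
      rw [← measure_cdf_le m hp]
      exact measure_mono fun z (hz : cdf m z ≤ 0) => hz.trans hp.1.le
  have h1 : ∀ᵐ z ∂m, cdf m z < 1 := by
    have hms : MeasurableSet {z | cdf m z < 1} :=
      (monotone_cdf m).measurable measurableSet_Iio
    change m {z | cdf m z < 1}ᶜ = 0
    rw [prob_compl_eq_zero_iff hms]
    refine le_antisymm prob_le_one
      (le_of_tendsto (x := 𝓝[<] (1 : ℝ)) (f := fun p => ENNReal.ofReal p) ?_ ?_)
    · have := (ENNReal.continuous_ofReal.tendsto (1 : ℝ)).mono_left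
        (nhdsWithin_le_nhds (s := Iio (1 : ℝ)))
      simpa using this
    · filter_upwards [Ioo_mem_nhdsLT (zero_lt_one' ℝ)] with p hp
      rw [← measure_cdf_le m hp]
      exact measure_mono fun z (hz : cdf m z ≤ p) => lt_of_le_of_lt hz hp.2
  filter_upwards [h0, h1] with z a b using ⟨a, b⟩

theorem map_gaussQuantile_cdf :
    m.map (fun z => gaussQuantile (cdf m z)) = gaussianReal 0 1 := by
  have : IsProbabilityMeasure (m.map fun z => gaussQuantile (cdf m z)) :=
    Measure.isProbabilityMeasure_map (measurable_gaussQuantile_cdf m).aemeasurable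
  refine Measure.ext_of_Iic _ _ fun t => ?_
  rw [Measure.map_apply (measurable_gaussQuantile_cdf m) measurableSet_Iic,
    ← ofReal_cdf (gaussianReal 0 1), ← measure_cdf_le m (cdf_gaussianReal_mem_Ioo t)]
  refine measure_congr ?_
  filter_upwards [ae_cdf_mem_Ioo m] with z hz
  exact propext (gaussQuantile_le_iff hz)

theorem memLp_gaussQuantile_cdf (p : ℝ≥0∞) (hp : p ≠ ∞) :
    MemLp (fun z => gaussQuantile (cdf m z)) p m := by
  have h := memLp_id_gaussianReal' (μ := 0) (v := 1) p hp
  rw [← map_gaussQuantile_cdf m] at h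
  exact h.comp_of_map (measurable_gaussQuantile_cdf m).aemeasurable

theorem integral_gaussQuantile_cdf : ∫ z, gaussQuantile (cdf m z) ∂m = 0 := by
  rw [← integral_id_gaussianReal (μ := 0) (v := 1), ← map_gaussQuantile_cdf m,
    integral_map (measurable_gaussQuantile_cdf m).aemeasurable (by fun_prop)]

/-- With `U = Φ⁻¹(F(Z))` one has `E[U 1{Z > z}] = φ(Φ⁻¹(F(z)))`, since the events `Z > z` and
`U > Φ⁻¹(F(z))` agree almost surely. -/
theorem setIntegral_Ioi_gaussQuantile_cdf {z : ℝ} (hz : cdf m z ∈ Ioo (0 : ℝ) 1) :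
    ∫ t in Ioi z, gaussQuantile (cdf m t) ∂m =
      gaussianPDFReal 0 1 (gaussQuantile (cdf m z)) := by
  have hle : (Iic z : Set ℝ) =ᵐ[m]
      (fun t => gaussQuantile (cdf m t)) ⁻¹' Iic (gaussQuantile (cdf m z)) := by
    have h1 : (Iic z : Set ℝ) =ᵐ[m] {t | cdf m t ≤ cdf m z} := by
      refine ae_eq_of_subset_of_measure_ge (fun t ht => monotone_cdf m ht) ?_
        measurableSet_Iic.nullMeasurableSet (measure_ne_top _ _)
      rw [measure_cdf_le m hz, ofReal_cdf]
    refine h1.trans ?_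
    filter_upwards [ae_cdf_mem_Ioo m] with t ht
    refine propext ?_
    change _ ↔ gaussQuantile (cdf m t) ≤ gaussQuantile (cdf m z)
    rw [gaussQuantile_le_iff ht, cdf_gaussQuantile hz]
    rfl
  have hgt : (Ioi z : Set ℝ) =ᵐ[m]
      (fun t => gaussQuantile (cdf m t)) ⁻¹' Ioi (gaussQuantile (cdf m z)) := by
    have := hle.compl
    rwa [compl_Iic, ← preimage_compl, compl_Iic] at this
  rw [setIntegral_congr_set hgt, ← setIntegral_Ioi_gaussianReal,
    ← map_gaussQuantile_cdf m, setIntegral_map measurableSet_Ioi (by fun_prop)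
      (measurable_gaussQuantile_cdf m).aemeasurable]

theorem setIntegral_Ioi_gaussQuantile_cdf_nonneg (z : ℝ) :
    0 ≤ ∫ t in Ioi z, gaussQuantile (cdf m t) ∂m := by
  by_cases hz : cdf m z ∈ Ioo (0 : ℝ) 1
  · rw [setIntegral_Ioi_gaussQuantile_cdf m hz]
    exact gaussianPDFReal_nonneg _ _ _
  -- at the ends of the support the tail is null or full
  rw [mem_Ioo, not_and_or, not_lt, not_lt] at hz
  have hI := (memLp_gaussQuantile_cdf m 1 (by simp)).integrable le_rfl
  have hcompl : ∫ t in Ioi z, gaussQuantile (cdf m t) ∂m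
      = - ∫ t in Iic z, gaussQuantile (cdf m t) ∂m := by
    have := integral_add_compl (measurableSet_Iic (a := z)) hI
    rw [compl_Iic, integral_gaussQuantile_cdf] at this
    linarith
  rcases hz with hz | hz
  · have h : m (Iic z) = 0 := by rw [← ofReal_cdf]; exact ENNReal.ofReal_eq_zero.2 hz
    rw [hcompl, setIntegral_measure_zero _ h, neg_zero]
  · have h : m (Ioi z) = 0 := by
      rw [← compl_Iic, prob_compl_eq_zero_iff measurableSet_Iic, ← ofReal_cdf,
        le_antisymm (cdf_le_one m z) hz, ENNReal.ofReal_one]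
    rw [setIntegral_measure_zero _ h]

/-- Layer-cake representation of the correlation: `∫ E[U 1{Z > z}] dz = E[Z U]`, where `E U = 0`
allows `1{Z > z}` to be replaced by the integrable kernel `1{Z > z} - 1{0 > z}`. -/
theorem integral_setIntegral_Ioi_gaussQuantile_cdf (hm : MemLp (fun z : ℝ => z) 2 m) :
    Integrable (fun z => ∫ t in Ioi z, gaussQuantile (cdf m t) ∂m) ∧
    ∫ z, (∫ t in Ioi z, gaussQuantile (cdf m t) ∂m) =
      ∫ z, z * gaussQuantile (cdf m z) ∂m := by
  set u : ℝ → ℝ := fun z => gaussQuantile (cdf m z) with hu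
  have hum : Measurable u := measurable_gaussQuantile_cdf m
  have hu2 : MemLp u 2 m := memLp_gaussQuantile_cdf m 2 (by simp)
  have hu1 : Integrable u m := hu2.integrable (by norm_num)
  have hu0 : ∫ z, u z ∂m = 0 := integral_gaussQuantile_cdf m
  -- `K t z = 1{z < t} - 1{z < 0}` has integral `t` in `z`, and `∫ |K t z| dz = |t|`
  set K : ℝ → ℝ → ℝ := fun t z => (Ico 0 t).indicator 1 z - (Ico t 0).indicator 1 z with hK
  have hKint : ∀ t, Integrable (K t) := fun t =>
    ((integrable_indicator_iff measurableSet_Ico).2 (integrableOn_const (by simp))).sub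
      ((integrable_indicator_iff measurableSet_Ico).2 (integrableOn_const (by simp)))
  have hKval : ∀ t, ∫ z, K t z = t := by
    intro t
    rw [hK]
    rw [integral_sub ((integrable_indicator_iff measurableSet_Ico).2 (integrableOn_const (by simp)))
      ((integrable_indicator_iff measurableSet_Ico).2 (integrableOn_const (by simp))),
      integral_indicator_one measurableSet_Ico, integral_indicator_one measurableSet_Ico]
    rcases le_total 0 t with h | h
    · simp [h]
    · simp [h]
  have hKabs : ∀ t, ∫ z, ‖K t z‖ = |t| := by
    intro t
    rcases le_total 0 t with h | h
    · have : ∀ z, ‖K t z‖ = K t z := by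
        intro z
        rw [Real.norm_eq_abs, abs_of_nonneg]
        simp only [hK, Ico_eq_empty (not_lt.2 h), indicator_empty, sub_zero]
        exact indicator_nonneg (fun _ _ => zero_le_one) _
      simp_rw [this, hKval, abs_of_nonneg h]
    · have : ∀ z, ‖K t z‖ = -K t z := by
        intro z
        rw [Real.norm_eq_abs, abs_of_nonpos]
        simp only [hK, Ico_eq_empty (not_lt.2 h), indicator_empty, zero_sub]
        rw [neg_nonpos]
        exact indicator_nonneg (fun _ _ => zero_le_one) _
      simp_rw [this, integral_neg, hKval, abs_of_nonpos h]
  have hKm : Measurable (fun p : ℝ × ℝ => K p.1 p.2) := by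
    have h1 : MeasurableSet {p : ℝ × ℝ | p.2 ∈ Ico 0 p.1} :=
      (measurableSet_le measurable_const measurable_snd).inter
        (measurableSet_lt measurable_snd measurable_fst)
    have h2 : MeasurableSet {p : ℝ × ℝ | p.2 ∈ Ico p.1 0} :=
      (measurableSet_le measurable_fst measurable_snd).inter
        (measurableSet_lt measurable_snd measurable_const)
    have e : (fun p : ℝ × ℝ => K p.1 p.2) = fun p =>
        {p : ℝ × ℝ | p.2 ∈ Ico 0 p.1}.indicator 1 p - {p : ℝ × ℝ | p.2 ∈ Ico p.1 0}.indicator 1 p := by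
      ext p
      simp [hK, indicator]
    rw [e]
    exact (measurable_one.indicator h1).sub (measurable_one.indicator h2)
  have hInt : Integrable (Function.uncurry fun t z => u t * K t z) (m.prod volume) := by
    have hms : AEStronglyMeasurable (Function.uncurry fun t z => u t * K t z) (m.prod volume) :=
      ((hum.comp measurable_fst).mul hKm).aestronglyMeasurable
    rw [integrable_prod_iff hms]
    refine ⟨ae_of_all _ fun t => (hKint t).const_mul (u t), ?_⟩
    have e : (fun t => ∫ z, ‖Function.uncurry (fun t z => u t * K t z) (t, z)‖) =
        fun t => ‖u t * t‖ := by
      ext t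
      simp only [Function.uncurry_apply_pair, norm_mul]
      rw [integral_const_mul, hKabs, Real.norm_eq_abs t]
    rw [e]
    exact (hu2.integrable_mul hm).norm
  have hinner : ∀ z, ∫ t, u t * K t z ∂m = ∫ t in Ioi z, u t ∂m := by
    intro z
    rcases le_or_gt 0 z with h | h
    · have e : ∀ t, u t * K t z = (Ioi z).indicator u t := by
        intro t
        by_cases ht : z < t
        · simp [hK, indicator, ht, h, h.not_gt]
        · simp [hK, indicator, ht, h, h.not_gt]
      simp_rw [e]
      exact integral_indicator measurableSet_Ioi
    · have e : ∀ t, u t * K t z = (Ioi z).indicator u t - u t := by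
        intro t
        by_cases ht : z < t
        · simp [hK, indicator, ht, h, ht.not_ge, h.not_ge]
        · simp [hK, indicator, ht, h, not_lt.1 ht, h.not_ge]
      simp_rw [e]
      rw [integral_sub (hu1.indicator measurableSet_Ioi) hu1, hu0, sub_zero]
      exact integral_indicator measurableSet_Ioi
  have hswap := integral_integral_swap hInt
  have hout : Integrable (fun z => ∫ t in Ioi z, u t ∂m) := by
    have := hInt.integral_prod_right
    simp only [Function.uncurry_apply_pair] at this
    simpa only [hinner] using this
  refine ⟨hout, ?_⟩
  simp_rw [integral_const_mul, hKval, hinner] at hswap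
  rw [← hswap]
  exact integral_congr_ae (ae_of_all _ fun t => mul_comm _ _)

theorem integral_mul_gaussQuantile_cdf_nonneg (hm : MemLp (fun z : ℝ => z) 2 m) :
    0 ≤ ∫ z, z * gaussQuantile (cdf m z) ∂m := by
  rw [← (integral_setIntegral_Ioi_gaussQuantile_cdf m hm).2]
  exact integral_nonneg (setIntegral_Ioi_gaussQuantile_cdf_nonneg m)

theorem lintegral_setIntegral_Ioi_gaussQuantile_cdf (hm : MemLp (fun z : ℝ => z) 2 m) :
    ∫⁻ z, ENNReal.ofReal (∫ t in Ioi z, gaussQuantile (cdf m t) ∂m) =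
      ENNReal.ofReal (∫ z, z * gaussQuantile (cdf m z) ∂m) := by
  obtain ⟨hout, h⟩ := integral_setIntegral_Ioi_gaussQuantile_cdf m hm
  rw [← h, ofReal_integral_eq_lintegral_ofReal hout
    (ae_of_all _ fun z => setIntegral_Ioi_gaussQuantile_cdf_nonneg m z)]

end OneDim

/-- For a law with density `g` on the line and `U = Φ⁻¹(F(Z))`, one has
`E[φ(U) / g(Z)] ≤ E[Z U]`. The left side is the mean of the derivative of the transport map. -/
theorem lintegral_gaussianPDFReal_div_le {g : ℝ → ℝ≥0∞} (hg : Measurable g)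
    [IsProbabilityMeasure (volume.withDensity g)]
    (hm : MemLp (fun z : ℝ => z) 2 (volume.withDensity g)) :
    ∫⁻ z, ENNReal.ofReal (gaussianPDFReal 0 1 (gaussQuantile (cdf (volume.withDensity g) z)) /
        (g z).toReal) ∂(volume.withDensity g) ≤
      ENNReal.ofReal (∫ z, z * gaussQuantile (cdf (volume.withDensity g) z)
        ∂(volume.withDensity g)) := by
  have : NullSingletonClass (volume.withDensity g) :=
    ⟨fun x => withDensity_absolutelyContinuous _ _ (measure_singleton x)⟩
  set m := volume.withDensity g with hmdef
  rw [← lintegral_setIntegral_Ioi_gaussQuantile_cdf m hm]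
  have hmeas : Measurable fun z => ENNReal.ofReal
      (gaussianPDFReal 0 1 (gaussQuantile (cdf m z)) / (g z).toReal) :=
    (((measurable_gaussianPDFReal 0 1).comp (measurable_gaussQuantile_cdf m)).div
      hg.ennreal_toReal).ennreal_ofReal
  conv_lhs => rw [hmdef, lintegral_withDensity_eq_lintegral_mul _ hg hmeas]
  have h1 := (ae_withDensity_iff hg).1 (ae_cdf_mem_Ioo m)
  have hgtop : ∀ᵐ z, g z < ∞ := by
    refine ae_lt_top hg ?_
    have := measure_ne_top m univ
    rwa [hmdef, withDensity_apply _ MeasurableSet.univ, setLIntegral_univ] at this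
  refine lintegral_mono_ae ?_
  filter_upwards [h1, hgtop] with z hz htop
  by_cases h0 : g z = 0
  · simp [h0]
  · rw [setIntegral_Ioi_gaussQuantile_cdf m (hz h0), Pi.mul_apply]
    have hpos : 0 < (g z).toReal := ENNReal.toReal_pos h0 htop.ne
    conv_lhs => rw [← ENNReal.ofReal_toReal htop.ne]
    rw [ENNReal.toReal_ofReal hpos.le, ← ENNReal.ofReal_mul hpos.le]
    rw [mul_div_cancel₀ _ hpos.ne']

/-! ### Disintegration of a density along the last coordinate -/

theorem MeasureTheory.MeasurePreserving.map_withDensity_equiv {X Y : Type*} [MeasurableSpace X]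
    [MeasurableSpace Y] {μ : Measure X} {ν : Measure Y} {e : X ≃ᵐ Y} (he : MeasurePreserving e μ ν)
    (f : X → ℝ≥0∞) : (μ.withDensity f).map e = ν.withDensity (f ∘ e.symm) := by
  ext s hs
  rw [e.map_apply, withDensity_apply _ (e.measurable hs), withDensity_apply _ hs, ← he.map_eq,
    e.restrict_map, lintegral_map_equiv]
  simp

/-- A law with density `f` on `X × ℝ` is the composition of its first marginal with a Markov
kernel that has a density `g x` for *every* `x`: the quotient `f (x, ·) / f₁ x` is replaced by a
Gaussian density on the null set where it is not a probability density. -/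
theorem exists_kernel_density {X : Type*} [MeasurableSpace X] {lam : Measure X} [SFinite lam]
    {f : X × ℝ → ℝ≥0∞} (hf : Measurable f)
    [IsProbabilityMeasure ((lam.prod volume).withDensity f)] :
    ∃ (g : X → ℝ → ℝ≥0∞) (κ : Kernel X ℝ) (_ : IsMarkovKernel κ),
      Measurable (Function.uncurry g) ∧ (∀ x, κ x = volume.withDensity (g x)) ∧
      (lam.prod volume).withDensity f =
        (lam.withDensity fun x => ∫⁻ t, f (x, t)) ⊗ₘ κ ∧
      ∀ᵐ p ∂(lam.prod volume), f p = (∫⁻ t, f (p.1, t)) * g p.1 p.2 := by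
  classical
  set f₁ : X → ℝ≥0∞ := fun x => ∫⁻ t, f (x, t) with hf₁
  have hf₁m : Measurable f₁ := hf.lintegral_prod_right'
  set B : Set X := {x | f₁ x = 0 ∨ f₁ x = ∞} with hB
  have hBm : MeasurableSet B :=
    (hf₁m (measurableSet_singleton 0)).union (hf₁m (measurableSet_singleton ∞))
  set g : X → ℝ → ℝ≥0∞ := fun x t => if x ∈ B then gaussianPDF 0 1 t else f (x, t) / f₁ x with hg
  have hgm : Measurable (Function.uncurry g) :=
    Measurable.ite (hBm.preimage measurable_fst)
      ((measurable_gaussianPDF 0 1).comp measurable_snd) (hf.div (hf₁m.comp measurable_fst))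
  have hg1 : ∀ x, ∫⁻ t, g x t = 1 := by
    intro x
    by_cases hx : x ∈ B
    · simp only [hg, hx, if_true]
      exact lintegral_gaussianPDF_eq_one 0 one_ne_zero
    · simp only [hg, hx, if_false]
      simp only [hB, mem_ofPred_eq, not_or] at hx
      simp_rw [div_eq_mul_inv]
      rw [lintegral_mul_const (f₁ x)⁻¹ (f := fun t => f (x, t)) (hf.comp measurable_prodMk_left)]
      exact ENNReal.mul_inv_cancel hx.1 hx.2
  set κ : Kernel X ℝ := (Kernel.const X volume).withDensity g with hκ
  have hκx : ∀ x, κ x = volume.withDensity (g x) := fun x => by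
    rw [hκ, Kernel.withDensity_apply _ hgm, Kernel.const_apply]
  have hM : IsMarkovKernel κ := ⟨fun x => ⟨by
    rw [hκx, withDensity_apply _ MeasurableSet.univ, setLIntegral_univ, hg1]⟩⟩
  have hfin : ∀ᵐ x ∂lam, f₁ x < ∞ := by
    refine ae_lt_top hf₁m ?_
    have h := measure_ne_top ((lam.prod volume).withDensity f) univ
    rwa [withDensity_apply _ MeasurableSet.univ, setLIntegral_univ,
      lintegral_prod _ hf.aemeasurable] at h
  have hfg' : ∀ᵐ x ∂lam, ∀ᵐ t, f (x, t) = f₁ x * g x t := by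
    filter_upwards [hfin] with x hx
    by_cases h0 : f₁ x = 0
    · have h := (lintegral_eq_zero_iff (hf.comp (measurable_prodMk_left (x := x)))).1 h0
      filter_upwards [h] with t ht
      rw [h0, zero_mul]
      exact ht
    · have hxB : x ∉ B := by simp [hB, h0, hx.ne]
      refine ae_of_all _ fun t => ?_
      simp only [hg, hxB, if_false]
      exact (ENNReal.mul_div_cancel h0 hx.ne).symm
  have hfg : ∀ᵐ p ∂(lam.prod volume), f p = f₁ p.1 * g p.1 p.2 :=
    (Measure.ae_prod_iff_ae_ae (measurableSet_eq_fun hf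
      ((hf₁m.comp measurable_fst).mul hgm))).2 hfg'
  refine ⟨g, κ, hM, hgm, hκx, ?_, hfg⟩
  ext s hs
  have hgx : ∀ x, Measurable (g x) := fun x => hgm.comp measurable_prodMk_left
  rw [withDensity_congr_ae hfg, withDensity_apply _ hs, ← lintegral_indicator hs,
    lintegral_prod (s.indicator fun p : X × ℝ => f₁ p.1 * g p.1 p.2)
      ((((hf₁m.comp measurable_fst).mul hgm).indicator hs).aemeasurable),
    Measure.compProd_apply hs, lintegral_withDensity_eq_lintegral_mul _ hf₁m
      (Kernel.measurable_kernel_prodMk_left hs)]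
  refine lintegral_congr fun x => ?_
  rw [Pi.mul_apply, hκx, withDensity_apply _ (measurable_prodMk_left hs),
    ← lintegral_indicator (measurable_prodMk_left hs),
    ← lintegral_const_mul _ ((hgx x).indicator (measurable_prodMk_left hs))]
  refine lintegral_congr fun t => ?_
  by_cases h : (x, t) ∈ s
  · simp [h]
  · simp [h]

/-! ### The conditional monotone map -/

section Kernel

variable {X : Type*} [MeasurableSpace X] (κ : Kernel X ℝ) [IsMarkovKernel κ]

theorem measurable_cdf_kernel : Measurable fun p : X × ℝ => cdf (κ p.1) p.2 := by
  simp_rw [cdf_eq_real]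
  have hs : MeasurableSet {q : (X × ℝ) × ℝ | q.2 ≤ q.1.2} :=
    measurableSet_le measurable_snd (measurable_snd.comp measurable_fst)
  have h := Kernel.measurable_kernel_prodMk_left (κ := κ.comap Prod.fst measurable_fst) hs
  exact h.ennreal_toReal

/-- The conditional quantile coupling: with `(x, z)` distributed as `ν ⊗ κ`, the value
`Φ⁻¹(F(z | x))` is standard normal and independent of `x`. -/
noncomputable def condGaussMap (p : X × ℝ) : ℝ := gaussQuantile (cdf (κ p.1) p.2)

theorem measurable_condGaussMap : Measurable (condGaussMap κ) :=
  measurable_gaussQuantile.comp (measurable_cdf_kernel κ)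

variable [∀ x, NullSingletonClass (κ x)]

theorem map_condGaussMap (ν : Measure X) [SFinite ν] :
    (ν ⊗ₘ κ).map (fun p => (p.1, condGaussMap κ p)) = ν.prod (gaussianReal 0 1) := by
  have hm : Measurable fun p : X × ℝ => (p.1, condGaussMap κ p) :=
    measurable_fst.prodMk (measurable_condGaussMap κ)
  ext s hs
  rw [Measure.map_apply hm hs, Measure.compProd_apply (hm hs), Measure.prod_apply hs]
  refine lintegral_congr fun x => ?_
  rw [← map_gaussQuantile_cdf (κ x), Measure.map_apply (measurable_gaussQuantile_cdf _)
    (measurable_prodMk_left hs)]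
  rfl

theorem memLp_condGaussMap (ν : Measure X) [IsProbabilityMeasure ν] (p : ℝ≥0∞) (hp : p ≠ ∞) :
    MemLp (condGaussMap κ) p (ν ⊗ₘ κ) := by
  have h := memLp_id_gaussianReal' (μ := 0) (v := 1) p hp
  have e : gaussianReal 0 1 = (ν ⊗ₘ κ).map (condGaussMap κ) := by
    rw [← Measure.snd_prod (μ := ν) (ν := gaussianReal 0 1), ← map_condGaussMap κ ν, Measure.snd,
      Measure.map_map measurable_snd (measurable_fst.prodMk (measurable_condGaussMap κ))]
    rfl
  rw [e] at h
  exact h.comp_of_map (measurable_condGaussMap κ).aemeasurable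

end Kernel

theorem lintegral_condGaussMap_le {X : Type*} [MeasurableSpace X] (κ : Kernel X ℝ)
    [IsMarkovKernel κ] {g : X → ℝ → ℝ≥0∞} (hg : Measurable (Function.uncurry g))
    (hκ : ∀ x, κ x = volume.withDensity (g x)) (ν : Measure X) [IsProbabilityMeasure ν]
    (hm : MemLp (fun p : X × ℝ => p.2) 2 (ν ⊗ₘ κ)) :
    ∫⁻ p, ENNReal.ofReal (gaussianPDFReal 0 1 (condGaussMap κ p) / (g p.1 p.2).toReal)
        ∂(ν ⊗ₘ κ) ≤
      ENNReal.ofReal (∫ p, p.2 * condGaussMap κ p ∂(ν ⊗ₘ κ)) := by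
  have hns : ∀ x, NullSingletonClass (κ x) := fun x => by
    rw [hκ]
    exact ⟨fun y => withDensity_absolutelyContinuous _ _ (measure_singleton y)⟩
  have hint : Integrable (fun p : X × ℝ => p.2 * condGaussMap κ p) (ν ⊗ₘ κ) :=
    hm.integrable_mul (memLp_condGaussMap κ ν 2 (by simp))
  have hsq : ∀ᵐ x ∂ν, MemLp (fun z : ℝ => z) 2 (κ x) := by
    have h := hm.integrable_sq
    rw [Measure.integrable_compProd_iff h.aestronglyMeasurable] at h
    filter_upwards [h.1] with x hx
    exact (memLp_two_iff_integrable_sq measurable_id.aestronglyMeasurable).2 hx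
  have hle : ∀ᵐ x ∂ν,
      ∫⁻ t, ENNReal.ofReal (gaussianPDFReal 0 1 (condGaussMap κ (x, t)) / (g x t).toReal) ∂(κ x) ≤
        ENNReal.ofReal (∫ t, t * condGaussMap κ (x, t) ∂(κ x)) := by
    filter_upwards [hsq] with x hx
    have hx1 : IsProbabilityMeasure (volume.withDensity (g x)) := hκ x ▸ inferInstance
    have h := lintegral_gaussianPDFReal_div_le (g := g x) (hg.comp (measurable_prodMk_left (x := x)))
      (hκ x ▸ hx)
    simp only [condGaussMap, hκ x]
    exact h
  have hnn : 0 ≤ᵐ[ν] fun x => ∫ t, t * condGaussMap κ (x, t) ∂(κ x) := by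
    filter_upwards [hsq] with x hx using integral_mul_gaussQuantile_cdf_nonneg (κ x) hx
  rw [Measure.lintegral_compProd, Measure.integral_compProd hint]
  · have hint' : Integrable (fun x => ∫ t, t * condGaussMap κ (x, t) ∂(κ x)) ν := by
      have h := Integrable.integral_compProd (κ := Kernel.const Unit ν)
        (η := Kernel.prodMkLeft Unit κ) (a := ()) hint
      simpa using h
    rw [ofReal_integral_eq_lintegral_ofReal hint' hnn]
    exact lintegral_mono_ae hle
  · exact (((measurable_gaussianPDFReal 0 1).comp (measurable_condGaussMap κ)).div
      hg.ennreal_toReal).ennreal_ofReal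

/-! ### The triangular map of a law on `ℝⁿ` to the standard Gaussian law -/

/-- The Knothe–Rosenblatt map. `S` sends the law with density `f` to the standard Gaussian law,
and `a i` plays the role of the `i`-th diagonal entry of the derivative of `S⁻¹`: their product
is the Jacobian `φ(S z) / f z`, and their means are bounded by the correlations `E[zᵢ Sᵢ(z)]`. -/
theorem exists_triangular_gaussian_map (n : ℕ) (f : (Fin n → ℝ) → ℝ≥0∞) (hf : Measurable f)
    (hP : IsProbabilityMeasure (volume.withDensity f))
    (h2 : ∀ i, MemLp (fun z : Fin n → ℝ => z i) 2 (volume.withDensity f)) :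
    ∃ S : (Fin n → ℝ) → (Fin n → ℝ), Measurable S ∧
      (volume.withDensity f).map S = Measure.pi (fun _ => gaussianReal 0 1) ∧
      ∃ a : Fin n → (Fin n → ℝ) → ℝ, (∀ i, Measurable (a i)) ∧
        (∀ᵐ z ∂(volume.withDensity f), (∀ i, 0 < a i z) ∧
          (∏ i, a i z) * (f z).toReal = ∏ i, gaussianPDFReal 0 1 (S z i)) ∧
        ∀ i, ∫⁻ z, ENNReal.ofReal (a i z) ∂(volume.withDensity f) ≤
          ENNReal.ofReal (∫ z, z i * S z i ∂(volume.withDensity f)) := by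
  induction n with
  | zero =>
    refine ⟨id, measurable_id, ?_, fun i => i.elim0, fun i => i.elim0, ?_, fun i => i.elim0⟩
    · rw [Measure.map_id, Measure.pi_of_empty]
      ext s hs
      rcases (Set.subsingleton_of_subsingleton (s := s)).eq_empty_or_singleton with h | ⟨x, h⟩
      · simp [h]
      · rw [show s = univ from h ▸ Set.eq_univ_of_forall fun y => Subsingleton.elim y x,
          measure_univ, measure_univ]
    · refine ae_of_all _ fun z => ⟨fun i => i.elim0, ?_⟩
      have h := hP.measure_univ
      rw [withDensity_apply _ MeasurableSet.univ, setLIntegral_univ, volume_pi,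
        Measure.pi_of_empty, lintegral_dirac, Subsingleton.elim isEmptyElim z] at h
      simp [h]
  | succ n ih =>
    -- the first coordinate is transported conditionally on the others, which the inductive
    -- hypothesis transports
    set E : (Fin (n + 1) → ℝ) ≃ᵐ (Fin n → ℝ) × ℝ :=
      (MeasurableEquiv.piFinSuccAbove (fun _ => ℝ) 0).trans MeasurableEquiv.prodComm with hE
    have hEvol : MeasurePreserving E volume ((volume : Measure (Fin n → ℝ)).prod volume) :=
      Measure.measurePreserving_swap.comp (volume_preserving_piFinSuccAbove (fun _ => ℝ) 0)
    have hEγ : MeasurePreserving E (Measure.pi fun _ => gaussianReal 0 1)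
        ((Measure.pi fun _ => gaussianReal 0 1).prod (gaussianReal 0 1)) :=
      Measure.measurePreserving_swap.comp
        (measurePreserving_piFinSuccAbove (fun _ => gaussianReal 0 1) 0)
    have hE1 : ∀ z j, (E z).1 j = z j.succ := fun z j => rfl
    have hE2 : ∀ z, (E z).2 = z 0 := fun z => rfl
    set μ := (volume : Measure (Fin (n + 1) → ℝ)).withDensity f with hμ
    have hfE : Measurable (f ∘ E.symm) := hf.comp E.symm.measurable
    have hmap : μ.map E = ((volume : Measure (Fin n → ℝ)).prod volume).withDensity (f ∘ E.symm) :=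
      hEvol.map_withDensity_equiv f
    have hPE : IsProbabilityMeasure
        (((volume : Measure (Fin n → ℝ)).prod volume).withDensity (f ∘ E.symm)) :=
      hmap ▸ Measure.isProbabilityMeasure_map E.measurable.aemeasurable
    obtain ⟨g, κ, hκM, hg, hκ, hdis, hfg⟩ := exists_kernel_density
      (lam := (volume : Measure (Fin n → ℝ))) hfE
    set f₁ : (Fin n → ℝ) → ℝ≥0∞ := fun x => ∫⁻ t, (f ∘ E.symm) (x, t) with hf₁
    have hf₁m : Measurable f₁ := hfE.lintegral_prod_right'
    set ν := (volume : Measure (Fin n → ℝ)).withDensity f₁ with hν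
    have hmapν : μ.map E = ν ⊗ₘ κ := hmap.trans hdis
    have hνfst : (μ.map E).map Prod.fst = ν := by
      rw [hmapν]
      exact Measure.fst_compProd ν κ
    have hνP : IsProbabilityMeasure ν := by
      have := Measure.isProbabilityMeasure_map (μ := μ) E.measurable.aemeasurable
      exact hνfst ▸ Measure.isProbabilityMeasure_map measurable_fst.aemeasurable
    have hmpE : MeasurePreserving E μ (ν ⊗ₘ κ) := ⟨E.measurable, hmapν⟩
    have hmp1 : MeasurePreserving (fun z => (E z).1) μ ν :=
      ⟨measurable_fst.comp E.measurable, by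
        rw [← hνfst, Measure.map_map measurable_fst E.measurable]; rfl⟩
    have hmemν : ∀ i, MemLp (fun x : Fin n → ℝ => x i) 2 ν := fun i =>
      hmp1.map_eq ▸ (memLp_map_measure_iff (measurable_pi_apply i).aestronglyMeasurable
        hmp1.measurable.aemeasurable).2 (h2 i.succ)
    have hmemκ : MemLp (fun p : (Fin n → ℝ) × ℝ => p.2) 2 (ν ⊗ₘ κ) :=
      hmapν ▸ (memLp_map_measure_iff measurable_snd.aestronglyMeasurable
        E.measurable.aemeasurable).2 (h2 0)
    obtain ⟨S', hS'm, hS'map, a', ha'm, ha', ha'le⟩ := ih f₁ hf₁m hνP hmemν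
    have hns : ∀ x, NullSingletonClass (κ x) := fun x => by
      rw [hκ]
      exact ⟨fun y => withDensity_absolutelyContinuous _ _ (measure_singleton y)⟩
    set u := condGaussMap κ with hu
    have hum : Measurable u := measurable_condGaussMap κ
    have hxu : Measurable fun p : (Fin n → ℝ) × ℝ => (p.1, u p) := measurable_fst.prodMk hum
    have hSm : Measurable fun z => E.symm (S' (E z).1, u (E z)) :=
      E.symm.measurable.comp (((hS'm.comp measurable_fst).prodMk hum).comp E.measurable)
    have hS0 : ∀ z, E.symm (S' (E z).1, u (E z)) 0 = u (E z) := fun z => by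
      rw [← hE2 (E.symm _), E.apply_symm_apply]
    have hSs : ∀ z j, E.symm (S' (E z).1, u (E z)) j.succ = S' (E z).1 j := fun z j => by
      rw [← hE1 (E.symm _), E.apply_symm_apply]
    have ha0m : Measurable fun p : (Fin n → ℝ) × ℝ =>
        gaussianPDFReal 0 1 (u p) / (g p.1 p.2).toReal :=
      ((measurable_gaussianPDFReal 0 1).comp hum).div hg.ennreal_toReal
    refine ⟨fun z => E.symm (S' (E z).1, u (E z)), hSm, ?_,
      Fin.cons (fun z => gaussianPDFReal 0 1 (u (E z)) / (g (E z).1 (E z).2).toReal)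
        (fun i z => a' i (E z).1), ?_, ?_, ?_⟩
    · have e : (fun z => E.symm (S' (E z).1, u (E z))) =
          E.symm ∘ Prod.map S' id ∘ (fun p => (p.1, u p)) ∘ E := rfl
      rw [e, ← Measure.map_map E.symm.measurable
          ((hS'm.prodMap measurable_id).comp (hxu.comp E.measurable)),
        ← Measure.map_map (hS'm.prodMap measurable_id) (hxu.comp E.measurable),
        ← Measure.map_map hxu E.measurable, hmapν, map_condGaussMap,
        ← Measure.map_prod_map _ _ hS'm measurable_id, hS'map, Measure.map_id]
      exact (hEγ.symm E).map_eq
    · intro i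
      refine Fin.cases ?_ (fun i => ?_) i
      · exact ha0m.comp E.measurable
      · exact (ha'm i).comp (measurable_fst.comp E.measurable)
    · have h1 : ∀ᵐ z ∂μ, f z = f₁ (E z).1 * g (E z).1 (E z).2 := by
        have h := hEvol.quasiMeasurePreserving.ae hfg
        refine (withDensity_absolutelyContinuous _ f).ae_le ?_
        filter_upwards [h] with z hz
        rwa [Function.comp_apply, E.symm_apply_apply] at hz
      have h2 : ∀ᵐ z ∂μ, f z ≠ 0 := (ae_withDensity_iff hf).2 (ae_of_all _ fun _ h => h)
      have h3 : ∀ᵐ z ∂μ, f z < ∞ := by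
        refine (withDensity_absolutelyContinuous _ f).ae_le (ae_lt_top hf ?_)
        have := measure_ne_top μ univ
        rwa [hμ, withDensity_apply _ MeasurableSet.univ, setLIntegral_univ] at this
      have h4 := hmp1.quasiMeasurePreserving.ae ha'
      filter_upwards [h1, h2, h3, h4] with z hz1 hz2 hz3 hz4
      have hg0 : g (E z).1 (E z).2 ≠ 0 := fun h => hz2 (by rw [hz1, h, mul_zero])
      have hf0 : f₁ (E z).1 ≠ 0 := fun h => hz2 (by rw [hz1, h, zero_mul])
      have hgt : g (E z).1 (E z).2 ≠ ∞ := fun h => hz3.ne (by rw [hz1, h, ENNReal.mul_top hf0])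
      have hgp : 0 < (g (E z).1 (E z).2).toReal := ENNReal.toReal_pos hg0 hgt
      constructor
      · intro i
        refine Fin.cases ?_ (fun i => ?_) i
        · exact div_pos (gaussianPDFReal_pos 0 1 _ one_ne_zero) hgp
        · exact hz4.1 i
      · rw [Fin.prod_univ_succ, Fin.prod_univ_succ]
        simp only [Fin.cons_zero, Fin.cons_succ, hS0, hSs]
        rw [← hz4.2, hz1, ENNReal.toReal_mul]
        field_simp
    · intro i
      refine Fin.cases ?_ (fun i => ?_) i
      · simp only [Fin.cons_zero, hS0]
        rw [hmpE.lintegral_comp (f := fun p => ENNReal.ofReal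
          (gaussianPDFReal 0 1 (u p) / (g p.1 p.2).toReal)) ha0m.ennreal_ofReal]
        have e : ∫ z, z 0 * u (E z) ∂μ = ∫ p, p.2 * u p ∂(ν ⊗ₘ κ) :=
          hmpE.integral_comp' (g := fun p : (Fin n → ℝ) × ℝ => p.2 * u p)
        rw [e]
        exact lintegral_condGaussMap_le κ hg hκ ν hmemκ
      · simp only [Fin.cons_succ, hSs]
        rw [hmp1.lintegral_comp (f := fun x => ENNReal.ofReal (a' i x)) (ha'm i).ennreal_ofReal]
        have e : ∫ z, z i.succ * S' (E z).1 i ∂μ = ∫ x, x i * S' x i ∂ν := by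
          rw [← hmp1.map_eq, integral_map hmp1.measurable.aemeasurable]
          · rfl
          · exact ((measurable_pi_apply i).mul
              ((measurable_pi_apply i).comp hS'm)).aestronglyMeasurable
        rw [e]
        exact ha'le i

/-! ### Moments of the standard Gaussian law -/

theorem integrable_pow_gaussianReal (k : ℕ) :
    Integrable (fun w : ℝ => w ^ k) (gaussianReal 0 1) := by
  rw [← integrable_norm_iff (by fun_prop)]
  have h := memLp_id_gaussianReal' (μ := 0) (v := 1) (k : ℝ≥0∞) (by simp)
  simpa [norm_pow] using MemLp.integrable_norm_pow' h

theorem integral_sq_gaussianReal : ∫ w, w ^ 2 ∂(gaussianReal 0 1) = 1 := by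
  have h := variance_fun_id_gaussianReal (μ := 0) (v := 1)
  rw [variance_of_integral_eq_zero (by fun_prop) (by simp)] at h
  simpa using h

/-- The bound comes from `24 (cosh w - 1 - w² / 2) ≥ w⁴`, whose mean is `24 (√e - 3 / 2)`. -/
theorem integral_pow_four_gaussianReal_le : ∫ w, w ^ 4 ∂(gaussianReal 0 1) ≤ 6 := by
  have hcosh : ∀ w : ℝ, w ^ 4 ≤ 24 * ((Real.exp w + Real.exp (-w)) / 2) - 24 - 12 * w ^ 2 := by
    intro w
    have h := sum_le_hasSum (Finset.range 3) (fun i _ => by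
      rw [pow_mul]; positivity) (Real.hasSum_cosh w)
    rw [Real.cosh_eq] at h
    simp [Finset.sum_range_succ, Nat.factorial] at h
    linarith
  have hmgf : ∀ t : ℝ, ∫ w, Real.exp (t * w) ∂(gaussianReal 0 1) = Real.exp (t ^ 2 / 2) := by
    intro t
    have h := congrFun (mgf_fun_id_gaussianReal (μ := 0) (v := 1)) t
    simpa [mgf] using h
  have he1 : Integrable (fun w : ℝ => Real.exp w) (gaussianReal 0 1) := by
    simpa using integrable_exp_mul_gaussianReal (μ := 0) (v := 1) 1
  have he2 : Integrable (fun w : ℝ => Real.exp (-w)) (gaussianReal 0 1) := by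
    simpa using integrable_exp_mul_gaussianReal (μ := 0) (v := 1) (-1)
  have hp := integrable_pow_gaussianReal
  have hsq := integral_sq_gaussianReal
  have hch : Integrable (fun w : ℝ => (Real.exp w + Real.exp (-w)) / 2) (gaussianReal 0 1) :=
    (he1.add he2).div_const 2
  have hi : Integrable (fun w : ℝ => 24 * ((Real.exp w + Real.exp (-w)) / 2) - 24)
      (gaussianReal 0 1) := (hch.const_mul 24).sub (integrable_const (24 : ℝ))
  have hi2 : Integrable (fun w : ℝ => 12 * w ^ 2) (gaussianReal 0 1) := (hp 2).const_mul 12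
  have h := integral_mono (hp 4) (hi.sub hi2) hcosh
  simp only [Pi.sub_apply] at h
  have e1 := hmgf 1
  have e2 := hmgf (-1)
  simp only [one_mul, neg_mul] at e1 e2
  rw [integral_sub hi hi2, integral_sub (hch.const_mul 24) (integrable_const _),
    integral_const_mul, integral_div, integral_add he1 he2, e1, e2, integral_const_mul, hsq] at h
  norm_num at h
  have hexp : Real.exp (1 / 2) ≤ 7 / 4 := by
    rw [← Real.sqrt_sq (show (0 : ℝ) ≤ 7 / 4 by norm_num), Real.exp_half]
    exact Real.sqrt_le_sqrt (by linarith [Real.exp_one_lt_d9])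
  linarith

section Moments

variable (n : ℕ)

theorem measurePreserving_toLp_gaussian :
    MeasurePreserving (MeasurableEquiv.toLp 2 (Fin n → ℝ)) (Measure.pi fun _ => gaussianReal 0 1)
      (stdGaussian (EuclideanSpace ℝ (Fin n))) :=
  ⟨(MeasurableEquiv.toLp 2 (Fin n → ℝ)).measurable, map_pi_eq_stdGaussian⟩

theorem memLp_sq_gaussianReal : MemLp (fun w : ℝ => w ^ 2) 2 (gaussianReal 0 1) := by
  rw [memLp_two_iff_integrable_sq (by fun_prop)]
  refine (integrable_pow_gaussianReal 4).congr (ae_of_all _ fun w => ?_)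
  ring

theorem memLp_normSq_stdGaussian :
    MemLp (fun y => ‖y‖ ^ 2) 2 (stdGaussian (EuclideanSpace ℝ (Fin n))) := by
  rw [← (measurePreserving_toLp_gaussian n).map_eq, MeasurableEquiv.memLp_map_measure_iff]
  have e : (fun y : EuclideanSpace ℝ (Fin n) => ‖y‖ ^ 2) ∘ (MeasurableEquiv.toLp 2 (Fin n → ℝ)) =
      fun w => ∑ i, w i ^ 2 := by
    ext w
    simp [EuclideanSpace.real_norm_sq_eq]
  rw [e]
  exact memLp_finsetSum _ fun i _ =>
    memLp_sq_gaussianReal.comp_measurePreserving (measurePreserving_eval _ i)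

theorem integral_normSq_stdGaussian :
    ∫ y, ‖y‖ ^ 2 ∂(stdGaussian (EuclideanSpace ℝ (Fin n))) = n := by
  rw [← (measurePreserving_toLp_gaussian n).integral_comp']
  have e : ∀ w : Fin n → ℝ, ‖(MeasurableEquiv.toLp 2 (Fin n → ℝ)) w‖ ^ 2 = ∑ i, w i ^ 2 := by
    intro w
    simp [EuclideanSpace.real_norm_sq_eq]
  simp_rw [e]
  rw [integral_finsetSum]
  · have h1 : ∀ i : Fin n, ∫ w : Fin n → ℝ, w i ^ 2 ∂(Measure.pi fun _ => gaussianReal 0 1) = 1 := by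
      intro i
      have hmp := measurePreserving_eval (fun _ : Fin n => gaussianReal 0 1) i
      have h := integral_map (μ := Measure.pi fun _ => gaussianReal 0 1)
        (f := fun w : ℝ => w ^ 2) hmp.measurable.aemeasurable (by fun_prop)
      rw [hmp.map_eq, integral_sq_gaussianReal] at h
      exact h.symm
    simp [h1]
  · exact fun i _ => (memLp_sq_gaussianReal.comp_measurePreserving
      (measurePreserving_eval _ i)).integrable (by norm_num)

theorem variance_normSq_stdGaussian_le :
    Var[fun y => ‖y‖ ^ 2; stdGaussian (EuclideanSpace ℝ (Fin n))] ≤ 6 * n := by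
  rw [← (measurePreserving_toLp_gaussian n).map_eq, variance_map (by fun_prop)
    (MeasurableEquiv.measurable _).aemeasurable]
  have e : (fun y : EuclideanSpace ℝ (Fin n) => ‖y‖ ^ 2) ∘ (MeasurableEquiv.toLp 2 (Fin n → ℝ)) =
      ∑ i, fun w => w i ^ 2 := by
    ext w
    simp [EuclideanSpace.real_norm_sq_eq]
  rw [e, variance_sum_pi (X := fun _ w => w ^ 2) fun _ => memLp_sq_gaussianReal]
  have h1 : Var[fun w : ℝ => w ^ 2; gaussianReal 0 1] ≤ 6 := by
    refine (variance_le_expectation_sq (by fun_prop)).trans ?_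
    refine le_trans (le_of_eq ?_) integral_pow_four_gaussianReal_le
    refine integral_congr_ae (ae_of_all _ fun w => ?_)
    simp only [Pi.pow_apply]
    ring
  refine (Finset.sum_le_card_nsmul _ _ 6 fun i _ => h1).trans (le_of_eq ?_)
  simp [mul_comm]

end Moments

/-! ### The Gaussian channel -/

theorem MeasureTheory.Measure.pi_withDensity_of_prob {ι : Type*} [Fintype ι] {X : ι → Type*}
    [∀ i, MeasurableSpace (X i)] (μ : ∀ i, Measure (X i)) [∀ i, IsProbabilityMeasure (μ i)]
    {k : ∀ i, X i → ℝ≥0∞} (hk : ∀ i, Measurable (k i))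
    [∀ i, SigmaFinite ((μ i).withDensity (k i))] :
    Measure.pi (fun i => (μ i).withDensity (k i)) =
      (Measure.pi μ).withDensity fun x => ∏ i, k i (x i) := by
  refine Measure.pi_eq fun s hs => ?_
  rw [withDensity_apply _ (MeasurableSet.univ_pi hs),
    ← lintegral_indicator (MeasurableSet.univ_pi hs)]
  have e : ∀ x : ∀ i, X i, (univ.pi s).indicator (fun x => ∏ i, k i (x i)) x =
      ∏ i, ((fun x : ∀ i, X i => (s i).indicator (k i) (x i)) x) := by
    intro x
    by_cases hx : x ∈ univ.pi s
    · rw [indicator_of_mem hx]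
      exact Finset.prod_congr rfl fun i _ => (indicator_of_mem (hx i (mem_univ i)) _).symm
    · rw [indicator_of_notMem hx]
      simp only [mem_univ_pi, not_forall] at hx
      obtain ⟨i, hi⟩ := hx
      exact (Finset.prod_eq_zero (Finset.mem_univ i) (indicator_of_notMem hi _)).symm
  simp_rw [e]
  rw [lintegral_prod_eq_prod_lintegral_of_indepFun Finset.univ
    (fun i (x : ∀ i, X i) => (s i).indicator (k i) (x i))
    (iIndepFun_pi fun i => ((hk i).indicator (hs i)).aemeasurable)
    fun i => ((hk i).indicator (hs i)).comp (measurable_pi_apply i)]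
  refine Finset.prod_congr rfl fun i _ => ?_
  rw [withDensity_apply _ (hs i), ← lintegral_indicator (hs i)]
  exact (measurePreserving_eval μ i).lintegral_comp ((hk i).indicator (hs i))

theorem gaussianReal_map_affine {s : ℝ} (hs : 0 < s) (b : ℝ) :
    (gaussianReal 0 1).map (fun w => b + s * w) = (gaussianReal 0 1).withDensity fun y =>
      ENNReal.ofReal (s⁻¹ * Real.exp (y ^ 2 / 2 - (y - b) ^ 2 / (2 * s ^ 2))) := by
  have hv : NNReal.mk (s ^ 2) (sq_nonneg s) ≠ 0 := by
    intro h
    have h' : s ^ 2 = 0 := congrArg NNReal.toReal h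
    exact hs.ne' (pow_eq_zero_iff two_ne_zero |>.1 h')
  have e : (fun w => b + s * w) = (fun w => b + w) ∘ (fun w => s * w) := rfl
  have e2 : gaussianReal 0 1 = volume.withDensity (gaussianPDF 0 1) :=
    gaussianReal_of_var_ne_zero 0 one_ne_zero
  rw [e, ← Measure.map_map (by fun_prop) (by fun_prop), gaussianReal_map_const_mul,
    gaussianReal_map_const_add, mul_zero, zero_add, mul_one, gaussianReal_of_var_ne_zero _ hv, e2,
    ← withDensity_mul _ (measurable_gaussianPDF 0 1) (by fun_prop)]
  congr 1
  ext y
  rw [Pi.mul_apply, gaussianPDF, gaussianPDF, ← ENNReal.ofReal_mul (gaussianPDFReal_nonneg _ _ _)]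
  congr 1
  simp only [gaussianPDFReal, NNReal.coe_mk, NNReal.coe_one, sub_zero, mul_one]
  rw [Real.sqrt_mul (by positivity), Real.sqrt_sq hs.le, mul_inv, mul_mul_mul_comm, ← Real.exp_add]
  congr 2
  ring

/-- Density at `y`, relative to the standard Gaussian law, of `b + s W` with `W` standard Gaussian
and `s > 0`. -/
noncomputable def channelDensity {n : ℕ} (s : ℝ) (b y : EuclideanSpace ℝ (Fin n)) : ℝ :=
  (s⁻¹) ^ n * Real.exp (‖y‖ ^ 2 / 2 - ‖y - b‖ ^ 2 / (2 * s ^ 2))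

theorem stdGaussian_map_affine {n : ℕ} {s : ℝ} (hs : 0 < s) (b : EuclideanSpace ℝ (Fin n)) :
    (stdGaussian (EuclideanSpace ℝ (Fin n))).map (fun w => b + s • w) =
      (stdGaussian (EuclideanSpace ℝ (Fin n))).withDensity fun y =>
        ENNReal.ofReal (channelDensity s b y) := by
  have hmp := measurePreserving_toLp_gaussian n
  have hk : ∀ i : Fin n, Measurable fun y : ℝ =>
      ENNReal.ofReal (s⁻¹ * Real.exp (y ^ 2 / 2 - (y - b i) ^ 2 / (2 * s ^ 2))) := by
    intro i; fun_prop
  have hP : ∀ i : Fin n, IsProbabilityMeasure ((gaussianReal 0 1).withDensity fun y =>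
      ENNReal.ofReal (s⁻¹ * Real.exp (y ^ 2 / 2 - (y - b i) ^ 2 / (2 * s ^ 2)))) := fun i => by
    rw [← gaussianReal_map_affine hs (b i)]
    exact Measure.isProbabilityMeasure_map (by fun_prop)
  have h1 : (Measure.pi fun _ : Fin n => gaussianReal 0 1).map (fun w i => b i + s * w i) =
      (Measure.pi fun _ : Fin n => gaussianReal 0 1).withDensity fun y => ∏ i, ENNReal.ofReal
        (s⁻¹ * Real.exp (y i ^ 2 / 2 - (y i - b i) ^ 2 / (2 * s ^ 2))) := by
    have hσ : ∀ i : Fin n, SigmaFinite ((gaussianReal 0 1).map fun w => b i + s * w) := fun i => by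
      rw [gaussianReal_map_affine hs (b i)]
      infer_instance
    rw [Measure.pi_map_pi (f := fun i w => b i + s * w) (fun i => by fun_prop),
      ← Measure.pi_withDensity_of_prob _ hk]
    simp_rw [gaussianReal_map_affine hs]
  conv_lhs => rw [← hmp.map_eq]
  rw [Measure.map_map (by fun_prop) hmp.measurable]
  have e : (fun w => b + s • w) ∘ (MeasurableEquiv.toLp 2 (Fin n → ℝ)) =
      (MeasurableEquiv.toLp 2 (Fin n → ℝ)) ∘ fun w i => b i + s * w i := by
    ext w i
    simp
  rw [e, ← Measure.map_map hmp.measurable (by fun_prop), h1, hmp.map_withDensity_equiv]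
  congr 1
  ext y
  rw [Function.comp_apply, ← ENNReal.ofReal_prod_of_nonneg fun i _ => by positivity,
    Finset.prod_mul_distrib, ← Real.exp_sum, channelDensity, EuclideanSpace.real_norm_sq_eq,
    EuclideanSpace.real_norm_sq_eq, Finset.sum_div, Finset.sum_div, ← Finset.sum_sub_distrib]
  simp

theorem stdGaussian_prod_map_add {n : ℕ} {r s : ℝ} (hrs : r ^ 2 + s ^ 2 = 1) :
    ((stdGaussian (EuclideanSpace ℝ (Fin n))).prod (stdGaussian (EuclideanSpace ℝ (Fin n)))).map
      (fun p => r • p.1 + s • p.2) = stdGaussian (EuclideanSpace ℝ (Fin n)) := by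
  set γ := stdGaussian (EuclideanSpace ℝ (Fin n)) with hγ
  have hP : ∀ t : ℝ, IsProbabilityMeasure (γ.map fun x => t • x) := fun t =>
    Measure.isProbabilityMeasure_map (by fun_prop)
  have e : (γ.prod γ).map (fun p => r • p.1 + s • p.2) =
      (γ.map fun x => r • x) ∗ (γ.map fun x => s • x) := by
    rw [Measure.conv, Measure.map_prod_map _ _ (by fun_prop) (by fun_prop),
      Measure.map_map (by fun_prop) (by fun_prop)]
    rfl
  have : IsProbabilityMeasure ((γ.prod γ).map (fun p => r • p.1 + s • p.2)) :=
    Measure.isProbabilityMeasure_map (by fun_prop)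
  refine Measure.ext_of_charFun ?_
  ext t
  rw [e, charFun_conv, charFun_map_smul, charFun_map_smul, hγ, charFun_stdGaussian,
    charFun_stdGaussian, charFun_stdGaussian, ← Complex.exp_add]
  congr 1
  have h : -(‖r • t‖ ^ 2) / 2 + -(‖s • t‖ ^ 2) / 2 = -(‖t‖ ^ 2) / 2 := by
    rw [norm_smul, norm_smul, Real.norm_eq_abs, Real.norm_eq_abs, mul_pow, mul_pow, sq_abs, sq_abs]
    linear_combination (-(‖t‖ ^ 2) / 2) * hrs
  exact_mod_cast congrArg Complex.ofReal h

/-! ### The coupling through a Gaussian channel -/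

/-- The joint law of `(Z, r S(Z) + s W)` for `Z` of law `μ` and an independent standard
Gaussian `W`. -/
noncomputable def gaussCoupling {Z : Type*} [MeasurableSpace Z] {n : ℕ} (μ : Measure Z)
    (S : Z → EuclideanSpace ℝ (Fin n)) (r s : ℝ) : Measure (Z × EuclideanSpace ℝ (Fin n)) :=
  (μ.prod (stdGaussian (EuclideanSpace ℝ (Fin n)))).map fun p => (p.1, r • S p.1 + s • p.2)

section Coupling

variable {Z : Type*} [MeasurableSpace Z] {n : ℕ} {μ : Measure Z}
  {S : Z → EuclideanSpace ℝ (Fin n)} {r s : ℝ}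

theorem measurable_gaussCoupling_map (hS : Measurable S) :
    Measurable fun p : Z × EuclideanSpace ℝ (Fin n) => (p.1, r • S p.1 + s • p.2) := by
  fun_prop

theorem measurePreserving_gaussCoupling_map (hS : Measurable S) :
    MeasurePreserving (fun p : Z × EuclideanSpace ℝ (Fin n) => (p.1, r • S p.1 + s • p.2))
      (μ.prod (stdGaussian (EuclideanSpace ℝ (Fin n)))) (gaussCoupling μ S r s) :=
  ⟨measurable_gaussCoupling_map hS, rfl⟩

theorem fst_gaussCoupling (hS : Measurable S) : (gaussCoupling μ S r s).fst = μ := by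
  rw [gaussCoupling, Measure.fst, Measure.map_map measurable_fst (measurable_gaussCoupling_map hS)]
  exact Measure.fst_prod

theorem measurable_channelDensity (hS : Measurable S) :
    Measurable fun p : Z × EuclideanSpace ℝ (Fin n) => channelDensity s (r • S p.1) p.2 := by
  unfold channelDensity
  fun_prop

/-- As `Z` enters the channel through the function `S`, the joint density is that of the Gaussian
channel at `S z`. Invertibility of `S` plays no role. -/
theorem gaussCoupling_eq_withDensity (hS : Measurable S) (hs : 0 < s) :
    gaussCoupling μ S r s = (μ.prod (stdGaussian (EuclideanSpace ℝ (Fin n)))).withDensity fun p =>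
      ENNReal.ofReal (channelDensity s (r • S p.1) p.2) := by
  ext t ht
  have hD := (measurable_channelDensity (r := r) (s := s) hS).ennreal_ofReal
  rw [gaussCoupling, Measure.map_apply (measurable_gaussCoupling_map hS) ht,
    Measure.prod_apply (measurable_gaussCoupling_map hS ht), withDensity_apply _ ht,
    ← lintegral_indicator ht, lintegral_prod _ (hD.indicator ht).aemeasurable]
  refine lintegral_congr fun z => ?_
  have htz : MeasurableSet (Prod.mk z ⁻¹' t) := measurable_prodMk_left ht
  have h := congrArg (fun m => m (Prod.mk z ⁻¹' t)) (stdGaussian_map_affine hs (r • S z))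
  simp only at h
  rw [Measure.map_apply (by fun_prop) htz, withDensity_apply _ htz, ← lintegral_indicator htz] at h
  exact h

variable [IsProbabilityMeasure μ]

theorem isProbabilityMeasure_gaussCoupling (hS : Measurable S) :
    IsProbabilityMeasure (gaussCoupling μ S r s) :=
  Measure.isProbabilityMeasure_map (measurable_gaussCoupling_map hS).aemeasurable

theorem measurePreserving_channel_output (hS : Measurable S)
    (hSμ : μ.map S = stdGaussian (EuclideanSpace ℝ (Fin n))) (hrs : r ^ 2 + s ^ 2 = 1) :
    MeasurePreserving (fun p : Z × EuclideanSpace ℝ (Fin n) => r • S p.1 + s • p.2)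
      (μ.prod (stdGaussian (EuclideanSpace ℝ (Fin n))))
      (stdGaussian (EuclideanSpace ℝ (Fin n))) := by
  refine ⟨by fun_prop, ?_⟩
  have e : (fun p : Z × EuclideanSpace ℝ (Fin n) => r • S p.1 + s • p.2) =
      (fun p => r • p.1 + s • p.2) ∘ Prod.map S id := rfl
  rw [e, ← Measure.map_map (by fun_prop) (hS.prodMap measurable_id),
    ← Measure.map_prod_map _ _ hS measurable_id, hSμ, Measure.map_id, stdGaussian_prod_map_add hrs]

theorem snd_gaussCoupling (hS : Measurable S)
    (hSμ : μ.map S = stdGaussian (EuclideanSpace ℝ (Fin n))) (hrs : r ^ 2 + s ^ 2 = 1) :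
    (gaussCoupling μ S r s).snd = stdGaussian (EuclideanSpace ℝ (Fin n)) := by
  rw [gaussCoupling, Measure.snd, Measure.map_map measurable_snd (measurable_gaussCoupling_map hS)]
  exact (measurePreserving_channel_output hS hSμ hrs).map_eq

/-- The centred information density of the coupling, as a function of `Z` and the noise `W`:
half of `‖Y‖² - ‖W‖²`, where `Y` is the channel output. -/
noncomputable def channelFluctuation (S : Z → EuclideanSpace ℝ (Fin n)) (r s : ℝ)
    (p : Z × EuclideanSpace ℝ (Fin n)) : ℝ :=
  (‖r • S p.1 + s • p.2‖ ^ 2 - ‖p.2‖ ^ 2) / 2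

theorem log_channelDensity (hs : 0 < s) (b w : EuclideanSpace ℝ (Fin n)) :
    Real.log (channelDensity s b (b + s • w)) =
      -(n * Real.log s) + (‖b + s • w‖ ^ 2 - ‖w‖ ^ 2) / 2 := by
  rw [channelDensity, Real.log_mul (by positivity) (Real.exp_ne_zero _), Real.log_exp, Real.log_pow,
    Real.log_inv, add_sub_cancel_left, norm_smul, mul_pow, Real.norm_eq_abs, sq_abs]
  field_simp

theorem rnDeriv_gaussCoupling (hS : Measurable S) (hs : 0 < s) :
    ∀ᵐ p ∂(gaussCoupling μ S r s), Real.log ((gaussCoupling μ S r s).rnDeriv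
      (μ.prod (stdGaussian (EuclideanSpace ℝ (Fin n)))) p).toReal =
        Real.log (channelDensity s (r • S p.1) p.2) := by
  have hD := (measurable_channelDensity (r := r) (s := s) hS).ennreal_ofReal
  have h := Measure.rnDeriv_withDensity (μ.prod (stdGaussian (EuclideanSpace ℝ (Fin n)))) hD
  rw [← gaussCoupling_eq_withDensity hS hs] at h
  have hac : gaussCoupling μ S r s ≪ μ.prod (stdGaussian (EuclideanSpace ℝ (Fin n))) := by
    rw [gaussCoupling_eq_withDensity hS hs]
    exact withDensity_absolutelyContinuous _ _
  filter_upwards [hac.ae_le h] with p hp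
  rw [hp, ENNReal.toReal_ofReal]
  unfold channelDensity
  positivity

theorem ae_log_rnDeriv_gaussCoupling (hS : Measurable S) (hs : 0 < s) :
    ∀ᵐ p ∂(μ.prod (stdGaussian (EuclideanSpace ℝ (Fin n)))),
      Real.log ((gaussCoupling μ S r s).rnDeriv
        (μ.prod (stdGaussian (EuclideanSpace ℝ (Fin n)))) (p.1, r • S p.1 + s • p.2)).toReal =
          -(n * Real.log s) + channelFluctuation S r s p := by
  have h := (measurePreserving_gaussCoupling_map (μ := μ) (r := r) (s := s)
    hS).quasiMeasurePreserving.ae (rnDeriv_gaussCoupling hS hs)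
  filter_upwards [h] with p hp
  rw [hp, log_channelDensity hs]
  rfl

theorem memLp_channelFluctuation (hS : Measurable S)
    (hSμ : μ.map S = stdGaussian (EuclideanSpace ℝ (Fin n))) (hrs : r ^ 2 + s ^ 2 = 1) :
    MemLp (channelFluctuation S r s) 2 (μ.prod (stdGaussian (EuclideanSpace ℝ (Fin n)))) := by
  have hY := (memLp_normSq_stdGaussian n).comp_measurePreserving
    (measurePreserving_channel_output hS hSμ hrs)
  have hW := (memLp_normSq_stdGaussian n).comp_measurePreserving
    (measurePreserving_snd (μ := μ) (ν := stdGaussian (EuclideanSpace ℝ (Fin n))))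
  have h := (hY.sub hW).mul_const (1 / 2)
  refine h.ae_eq (ae_of_all _ fun p => ?_)
  simp [channelFluctuation]
  ring

theorem integral_channelFluctuation (hS : Measurable S)
    (hSμ : μ.map S = stdGaussian (EuclideanSpace ℝ (Fin n))) (hrs : r ^ 2 + s ^ 2 = 1) :
    ∫ p, channelFluctuation S r s p ∂(μ.prod (stdGaussian (EuclideanSpace ℝ (Fin n)))) = 0 := by
  have hmY := measurePreserving_channel_output hS hSμ hrs
  have hmW := measurePreserving_snd (μ := μ) (ν := stdGaussian (EuclideanSpace ℝ (Fin n)))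
  have hY : Integrable (fun p : Z × EuclideanSpace ℝ (Fin n) => ‖r • S p.1 + s • p.2‖ ^ 2)
      (μ.prod (stdGaussian (EuclideanSpace ℝ (Fin n)))) :=
    ((memLp_normSq_stdGaussian n).comp_measurePreserving hmY).integrable (by norm_num)
  have hW : Integrable (fun p : Z × EuclideanSpace ℝ (Fin n) => ‖p.2‖ ^ 2)
      (μ.prod (stdGaussian (EuclideanSpace ℝ (Fin n)))) :=
    ((memLp_normSq_stdGaussian n).comp_measurePreserving hmW).integrable (by norm_num)
  have eY := integral_map (μ := μ.prod (stdGaussian (EuclideanSpace ℝ (Fin n))))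
    (f := fun y : EuclideanSpace ℝ (Fin n) => ‖y‖ ^ 2)
    hmY.measurable.aemeasurable (by fun_prop)
  have eW := integral_map (μ := μ.prod (stdGaussian (EuclideanSpace ℝ (Fin n))))
    (f := fun y : EuclideanSpace ℝ (Fin n) => ‖y‖ ^ 2)
    hmW.measurable.aemeasurable (by fun_prop)
  rw [hmY.map_eq, integral_normSq_stdGaussian] at eY
  rw [hmW.map_eq, integral_normSq_stdGaussian] at eW
  simp only [channelFluctuation]
  rw [integral_div, integral_sub hY hW, ← eY, ← eW]
  simp

/-- The fluctuation is half the difference of two variables distributed as `‖W‖²`, so its variance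
is at most that of `‖W‖²`, whatever their dependence. -/
theorem variance_channelFluctuation_le (hS : Measurable S)
    (hSμ : μ.map S = stdGaussian (EuclideanSpace ℝ (Fin n))) (hrs : r ^ 2 + s ^ 2 = 1) :
    Var[channelFluctuation S r s; μ.prod (stdGaussian (EuclideanSpace ℝ (Fin n)))] ≤ 6 * n := by
  have hmY := measurePreserving_channel_output hS hSμ hrs
  have hmW := measurePreserving_snd (μ := μ) (ν := stdGaussian (EuclideanSpace ℝ (Fin n)))
  set Q := μ.prod (stdGaussian (EuclideanSpace ℝ (Fin n)))
  set N : EuclideanSpace ℝ (Fin n) → ℝ := fun y => ‖y‖ ^ 2 with hN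
  have hNm : AEMeasurable N (stdGaussian (EuclideanSpace ℝ (Fin n))) := by fun_prop
  have hY : MemLp (fun p : Z × EuclideanSpace ℝ (Fin n) => N (r • S p.1 + s • p.2)) 2 Q :=
    (memLp_normSq_stdGaussian n).comp_measurePreserving hmY
  have hW : MemLp (fun p : Z × EuclideanSpace ℝ (Fin n) => N p.2) 2 Q :=
    (memLp_normSq_stdGaussian n).comp_measurePreserving hmW
  have vY : Var[fun p : Z × EuclideanSpace ℝ (Fin n) => N (r • S p.1 + s • p.2); Q] ≤ 6 * n :=
    (hmY.variance_fun_comp hNm).trans_le (variance_normSq_stdGaussian_le n)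
  have vW : Var[fun p : Z × EuclideanSpace ℝ (Fin n) => N p.2; Q] ≤ 6 * n :=
    (hmW.variance_fun_comp hNm).trans_le (variance_normSq_stdGaussian_le n)
  have e : channelFluctuation S r s =
      fun p => (1 / 2) * (N (r • S p.1 + s • p.2) - N p.2) := by
    ext p
    simp only [channelFluctuation, hN]
    ring
  -- `Var (A - B) = 2 Var A + 2 Var B - Var (A + B)`
  have h1 := variance_fun_sub hY hW
  have h2 := variance_fun_add hY hW
  have h3 := variance_nonneg
    (fun p : Z × EuclideanSpace ℝ (Fin n) => N (r • S p.1 + s • p.2) + N p.2) Q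
  rw [e, variance_const_mul]
  linarith

theorem mutualInfo_gaussCoupling (hS : Measurable S)
    (hSμ : μ.map S = stdGaussian (EuclideanSpace ℝ (Fin n))) (hrs : r ^ 2 + s ^ 2 = 1)
    (hs : 0 < s) :
    InfoOT.mutualInfo (gaussCoupling μ S r s) = ENNReal.ofReal (-(n * Real.log s)) := by
  have hP := isProbabilityMeasure_gaussCoupling (μ := μ) (r := r) (s := s) hS
  have hac : gaussCoupling μ S r s ≪ μ.prod (stdGaussian (EuclideanSpace ℝ (Fin n))) := by
    rw [gaussCoupling_eq_withDensity hS hs]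
    exact withDensity_absolutelyContinuous _ _
  have hmp := measurePreserving_gaussCoupling_map (μ := μ) (r := r) (s := s) hS
  have hae := ae_log_rnDeriv_gaussCoupling (μ := μ) (r := r) (s := s) hS hs
  have hllrm : AEStronglyMeasurable (llr (gaussCoupling μ S r s)
      (μ.prod (stdGaussian (EuclideanSpace ℝ (Fin n))))) (gaussCoupling μ S r s) :=
    (stronglyMeasurable_llr _ _).aestronglyMeasurable
  have hTint := (memLp_channelFluctuation hS hSμ hrs).integrable (by norm_num)
  have hint : Integrable (llr (gaussCoupling μ S r s)
      (μ.prod (stdGaussian (EuclideanSpace ℝ (Fin n))))) (gaussCoupling μ S r s) := by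
    rw [← hmp.integrable_comp hllrm]
    exact ((integrable_const (-(n * Real.log s))).add hTint).congr (hae.mono fun p hp => hp.symm)
  have hval : ∫ p, llr (gaussCoupling μ S r s)
      (μ.prod (stdGaussian (EuclideanSpace ℝ (Fin n)))) p ∂(gaussCoupling μ S r s) =
        -(n * Real.log s) := by
    conv_lhs => rw [← hmp.map_eq]
    rw [integral_map hmp.measurable.aemeasurable (hmp.map_eq.symm ▸ hllrm)]
    have e := integral_congr_ae hae
    rw [integral_add (integrable_const _) hTint, integral_channelFluctuation hS hSμ hrs] at e
    refine Eq.trans ?_ (e.trans (by simp))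
    rfl
  rw [InfoOT.mutualInfo, fst_gaussCoupling hS, snd_gaussCoupling hS hSμ hrs,
    InformationTheory.klDiv_of_ac_of_integrable hac hint, hval]
  simp

theorem infoDensityConstraint_gaussCoupling (hS : Measurable S)
    (hSμ : μ.map S = stdGaussian (EuclideanSpace ℝ (Fin n))) (hrs : r ^ 2 + s ^ 2 = 1)
    (hn : 0 < n) {R : ℝ≥0} (hs : s = Real.exp (-(R / n))) (τ : ℝ≥0) :
    InfoOT.InfoDensityConstraint (gaussCoupling μ S r s) R τ (6 * (n : ℝ≥0∞) / (τ : ℝ≥0∞) ^ 2) := by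
  have hs0 : 0 < s := hs ▸ Real.exp_pos _
  have hn' : (n : ℝ) ≠ 0 := by positivity
  have hR : -(n * Real.log s) = R := by
    rw [hs, Real.log_exp]
    field_simp
  have hI : InfoOT.mutualInfo (gaussCoupling μ S r s) = R := by
    rw [mutualInfo_gaussCoupling hS hSμ hrs hs0, hR, ENNReal.ofReal_coe_nnreal]
  refine ⟨hI.le, ?_⟩
  -- for `τ = 0` the quotient is `∞`, as `n` is positive, and the constraint is void
  rcases eq_or_ne τ 0 with rfl | hτ
  · rw [ENNReal.coe_zero, zero_pow two_ne_zero, ENNReal.div_zero (by simp [hn.ne'])]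
    simp
  have hτ0 : (0 : ℝ) < τ := by positivity
  have hmp := measurePreserving_gaussCoupling_map (μ := μ) (r := r) (s := s) hS
  set Q := μ.prod (stdGaussian (EuclideanSpace ℝ (Fin n))) with hQ
  have hae := ae_log_rnDeriv_gaussCoupling (μ := μ) (r := r) (s := s) hS hs0
  have hTm := memLp_channelFluctuation hS hSμ hrs
  have hdens : Measurable (InfoOT.infoDensity (gaussCoupling μ S r s)) :=
    (Measure.measurable_rnDeriv _ _).ennreal_toReal.log
  have hset : MeasurableSet {w | |InfoOT.infoDensity (gaussCoupling μ S r s) w -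
      (InfoOT.mutualInfo (gaussCoupling μ S r s)).toReal| ≤ τ} :=
    measurableSet_le (hdens.sub_const _).abs measurable_const
  have hch : Q {p | (τ : ℝ) ≤ |channelFluctuation S r s p|} ≤
      6 * (n : ℝ≥0∞) / (τ : ℝ≥0∞) ^ 2 := by
    have h := meas_ge_le_variance_div_sq hTm hτ0
    rw [integral_channelFluctuation hS hSμ hrs] at h
    simp only [sub_zero] at h
    refine h.trans ?_
    have h6 : Var[channelFluctuation S r s; Q] / (τ : ℝ) ^ 2 ≤ 6 * n / (τ : ℝ) ^ 2 := by
      gcongr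
      exact variance_channelFluctuation_le hS hSμ hrs
    refine (ENNReal.ofReal_le_ofReal h6).trans (le_of_eq ?_)
    rw [ENNReal.ofReal_div_of_pos (by positivity), ENNReal.ofReal_mul (by norm_num),
      ENNReal.ofReal_pow hτ0.le, ENNReal.ofReal_coe_nnreal, ENNReal.ofReal_natCast]
    simp
  rw [← hmp.measure_preimage hset.nullMeasurableSet, tsub_le_iff_right]
  have huniv : (1 : ℝ≥0∞) = Q univ := measure_univ.symm
  rw [huniv]
  refine le_trans ?_ (add_le_add_right hch _)
  refine le_trans (measure_mono_ae ?_) (measure_union_le _ _)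
  filter_upwards [hae] with p hp _
  have hid : InfoOT.infoDensity (gaussCoupling μ S r s) (p.1, r • S p.1 + s • p.2) =
      R + channelFluctuation S r s p := by
    rw [InfoOT.infoDensity, fst_gaussCoupling hS, snd_gaussCoupling hS hSμ hrs, hp, hR]
  rcases le_total |channelFluctuation S r s p| τ with h | h
  · left
    change |InfoOT.infoDensity (gaussCoupling μ S r s) (p.1, r • S p.1 + s • p.2) -
      (InfoOT.mutualInfo (gaussCoupling μ S r s)).toReal| ≤ τ
    rw [hid, hI]
    simpa using h
  · right
    exact h

end Coupling

/-- Transport cost of the coupling: the noise is uncorrelated with `Z`. The nonnegativity makes the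
truncation in `ENNReal.ofReal` harmless. -/
theorem lintegral_edist_gaussCoupling {n : ℕ} {μ : Measure (EuclideanSpace ℝ (Fin n))}
    [IsProbabilityMeasure μ] {S : EuclideanSpace ℝ (Fin n) → EuclideanSpace ℝ (Fin n)}
    (hS : Measurable S) (hSμ : μ.map S = stdGaussian (EuclideanSpace ℝ (Fin n))) {r s : ℝ}
    (hrs : r ^ 2 + s ^ 2 = 1) (hμ : Integrable (fun z => ‖z‖ ^ 2) μ) :
    0 ≤ ∫ z, ‖z‖ ^ 2 ∂μ + n - 2 * r * ∫ z, inner ℝ z (S z) ∂μ ∧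
    ∫⁻ w, edist w.1 w.2 ^ (2 : ℝ) ∂(gaussCoupling μ S r s) =
      ENNReal.ofReal (∫ z, ‖z‖ ^ 2 ∂μ + n - 2 * r * ∫ z, inner ℝ z (S z) ∂μ) := by
  set γ := stdGaussian (EuclideanSpace ℝ (Fin n)) with hγ
  have hmp := measurePreserving_gaussCoupling_map (μ := μ) (r := r) (s := s) hS
  have hmY := measurePreserving_channel_output hS hSμ hrs
  rw [← hmp.lintegral_comp (f := fun w => edist w.1 w.2 ^ (2 : ℝ)) (by fun_prop)]
  have hz : MemLp (fun z : EuclideanSpace ℝ (Fin n) => z) 2 μ :=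
    (memLp_two_iff_integrable_sq_norm aestronglyMeasurable_id).2 hμ
  have hw : MemLp (fun z : EuclideanSpace ℝ (Fin n) => z) 2 γ :=
    (memLp_two_iff_integrable_sq_norm aestronglyMeasurable_id).2
      ((memLp_normSq_stdGaussian n).integrable (by norm_num))
  have hSL : MemLp S 2 μ := by
    have h := hw
    rw [← hSμ] at h
    exact h.comp_of_map hS.aemeasurable
  have hzQ : MemLp (fun p : EuclideanSpace ℝ (Fin n) × EuclideanSpace ℝ (Fin n) => p.1) 2
      (μ.prod γ) := hz.comp_measurePreserving measurePreserving_fst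
  have hwQ : MemLp (fun p : EuclideanSpace ℝ (Fin n) × EuclideanSpace ℝ (Fin n) => p.2) 2
      (μ.prod γ) := hw.comp_measurePreserving measurePreserving_snd
  have hSQ : MemLp (fun p : EuclideanSpace ℝ (Fin n) × EuclideanSpace ℝ (Fin n) => S p.1) 2
      (μ.prod γ) := hSL.comp_measurePreserving measurePreserving_fst
  have hYQ : MemLp (fun p : EuclideanSpace ℝ (Fin n) × EuclideanSpace ℝ (Fin n) =>
      r • S p.1 + s • p.2) 2 (μ.prod γ) := hw.comp_measurePreserving hmY
  have hinn : ∀ f g : EuclideanSpace ℝ (Fin n) × EuclideanSpace ℝ (Fin n) →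
      EuclideanSpace ℝ (Fin n), MemLp f 2 (μ.prod γ) → MemLp g 2 (μ.prod γ) →
      Integrable (fun p => inner ℝ (f p) (g p)) (μ.prod γ) := fun f g hf hg => by
    refine (hf.norm.integrable_mul hg.norm).mono
      (hf.aestronglyMeasurable.inner hg.aestronglyMeasurable) (ae_of_all _ fun p => ?_)
    simpa using abs_real_inner_le_norm (f p) (g p)
  have i1 := hzQ.integrable_norm_pow two_ne_zero
  have i2 := hYQ.integrable_norm_pow two_ne_zero
  have i3 := hinn _ _ hzQ hSQ
  have i4 := hinn _ _ hzQ hwQ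
  have i12 : Integrable (fun p : EuclideanSpace ℝ (Fin n) × EuclideanSpace ℝ (Fin n) =>
      ‖p.1‖ ^ 2 + ‖r • S p.1 + s • p.2‖ ^ 2) (μ.prod γ) := i1.add i2
  have i34 : Integrable (fun p : EuclideanSpace ℝ (Fin n) × EuclideanSpace ℝ (Fin n) =>
      2 * r * inner ℝ p.1 (S p.1) + 2 * s * inner ℝ p.1 p.2) (μ.prod γ) :=
    (i3.const_mul (2 * r)).add (i4.const_mul (2 * s))
  have e : ∀ p : EuclideanSpace ℝ (Fin n) × EuclideanSpace ℝ (Fin n),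
      edist p.1 (r • S p.1 + s • p.2) ^ (2 : ℝ) = ENNReal.ofReal
        (‖p.1‖ ^ 2 + ‖r • S p.1 + s • p.2‖ ^ 2 -
          (2 * r * inner ℝ p.1 (S p.1) + 2 * s * inner ℝ p.1 p.2)) := by
    intro p
    rw [edist_dist, dist_eq_norm, ENNReal.ofReal_rpow_of_nonneg (norm_nonneg _) (by norm_num),
      Real.rpow_two, norm_sub_sq_real, inner_add_right, real_inner_smul_right,
      real_inner_smul_right]
    congr 1
    ring
  have hI : Integrable (fun p : EuclideanSpace ℝ (Fin n) × EuclideanSpace ℝ (Fin n) =>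
      ‖p.1‖ ^ 2 + ‖r • S p.1 + s • p.2‖ ^ 2 -
          (2 * r * inner ℝ p.1 (S p.1) + 2 * s * inner ℝ p.1 p.2)) (μ.prod γ) :=
    i12.sub i34
  have hnn : ∀ p : EuclideanSpace ℝ (Fin n) × EuclideanSpace ℝ (Fin n),
      0 ≤ ‖p.1‖ ^ 2 + ‖r • S p.1 + s • p.2‖ ^ 2 -
          (2 * r * inner ℝ p.1 (S p.1) + 2 * s * inner ℝ p.1 p.2) := by
    intro p
    have h := sq_nonneg ‖p.1 - (r • S p.1 + s • p.2)‖
    rw [norm_sub_sq_real, inner_add_right, real_inner_smul_right, real_inner_smul_right] at h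
    linarith
  have hval : ∫ p : EuclideanSpace ℝ (Fin n) × EuclideanSpace ℝ (Fin n),
      (‖p.1‖ ^ 2 + ‖r • S p.1 + s • p.2‖ ^ 2 -
          (2 * r * inner ℝ p.1 (S p.1) + 2 * s * inner ℝ p.1 p.2)) ∂(μ.prod γ) =
      ∫ z, ‖z‖ ^ 2 ∂μ + n - 2 * r * ∫ z, inner ℝ z (S z) ∂μ := by
    have e1 : ∫ p, ‖p.1‖ ^ 2 ∂(μ.prod γ) = ∫ z, ‖z‖ ^ 2 ∂μ := by
      rw [integral_fun_fst (fun z : EuclideanSpace ℝ (Fin n) => ‖z‖ ^ 2)]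
      simp
    have e2 : ∫ p : EuclideanSpace ℝ (Fin n) × EuclideanSpace ℝ (Fin n),
        ‖r • S p.1 + s • p.2‖ ^ 2 ∂(μ.prod γ) = n := by
      have h := integral_map (μ := μ.prod γ) (f := fun y : EuclideanSpace ℝ (Fin n) => ‖y‖ ^ 2)
        hmY.measurable.aemeasurable (by fun_prop)
      rw [hmY.map_eq, integral_normSq_stdGaussian] at h
      exact h.symm
    have e3 : ∫ p, inner ℝ p.1 (S p.1) ∂(μ.prod γ) = ∫ z, inner ℝ z (S z) ∂μ := by
      rw [integral_fun_fst (fun z : EuclideanSpace ℝ (Fin n) => inner ℝ z (S z))]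
      simp
    have e4 : ∫ p, inner ℝ p.1 p.2 ∂(μ.prod γ) = 0 := by
      rw [integral_prod _ i4]
      have h : ∀ z : EuclideanSpace ℝ (Fin n), ∫ w, inner ℝ z w ∂γ = 0 := by
        intro z
        rw [integral_inner (hw.integrable (by norm_num)), integral_id_stdGaussian, inner_zero_right]
      simp [h]
    rw [integral_sub i12 i34, integral_add i1 i2,
      integral_add (i3.const_mul (2 * r)) (i4.const_mul (2 * s)),
      integral_const_mul, integral_const_mul, e1, e2, e3, e4]
    ring
  refine ⟨hval ▸ integral_nonneg hnn, ?_⟩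
  simp_rw [e]
  rw [← ofReal_integral_eq_lintegral_ofReal hI (ae_of_all _ hnn), hval]

/-! ### The entropy power bound for the correlation -/

theorem pi_gaussianReal_absolutelyContinuous (n : ℕ) :
    (Measure.pi fun _ : Fin n => gaussianReal 0 1) ≪ (volume : Measure (Fin n → ℝ)) := by
  induction n with
  | zero =>
    rw [volume_pi, Measure.pi_of_empty, Measure.pi_of_empty]
  | succ n ih =>
    have h1 := (measurePreserving_piFinSuccAbove (fun _ : Fin (n + 1) => gaussianReal 0 1) 0).symm
    have h2 := (volume_preserving_piFinSuccAbove (fun _ : Fin (n + 1) => ℝ) 0).symm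
    rw [← h1.map_eq, ← h2.map_eq]
    exact ((gaussianReal_absolutelyContinuous 0 one_ne_zero).prod ih).map h1.measurable

theorem stdGaussian_absolutelyContinuous (n : ℕ) :
    stdGaussian (EuclideanSpace ℝ (Fin n)) ≪ volume := by
  rw [← (measurePreserving_toLp_gaussian n).map_eq, ← (PiLp.volume_preserving_toLp (Fin n)).map_eq]
  exact (pi_gaussianReal_absolutelyContinuous n).map (MeasurableEquiv.measurable _)

/-- The two halves of the differential entropy as integrals with respect to the law itself. -/
theorem differentialEntropy_eq {E : Type*} [MeasureSpace E] [SigmaFinite (volume : Measure E)]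
    (μ : Measure E) [IsFiniteMeasure μ] (hμ : μ ≪ volume) :
    InfoOT.differentialEntropy μ =
      ((∫⁻ x, ENNReal.ofReal (-Real.log (μ.rnDeriv volume x).toReal) ∂μ : ℝ≥0∞) : EReal) -
      ((∫⁻ x, ENNReal.ofReal (Real.log (μ.rnDeriv volume x).toReal) ∂μ : ℝ≥0∞) : EReal) := by
  have hm := Measure.measurable_rnDeriv μ volume
  have hlt := Measure.rnDeriv_lt_top μ volume
  have key : ∀ σ : ℝ → ℝ, Measurable σ → ∫⁻ x, ENNReal.ofReal (σ (μ.rnDeriv volume x).toReal) ∂μ =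
      ∫⁻ x, ENNReal.ofReal ((μ.rnDeriv volume x).toReal * σ (μ.rnDeriv volume x).toReal) := by
    intro σ hσ
    conv_lhs => rw [← Measure.withDensity_rnDeriv_eq μ volume hμ]
    rw [lintegral_withDensity_eq_lintegral_mul₀]
    · refine lintegral_congr_ae ?_
      filter_upwards [hlt] with x hx
      rw [ENNReal.ofReal_mul ENNReal.toReal_nonneg, ENNReal.ofReal_toReal hx.ne]
      rw [Measure.withDensity_rnDeriv_eq μ volume hμ]
      rfl
    · fun_prop
    · fun_prop
  have k1 := key (fun x => -Real.log x) (by fun_prop)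
  have k2 := key Real.log Real.measurable_log
  rw [InfoOT.differentialEntropy, k1, k2]
  simp only [Real.negMulLog, neg_mul, mul_neg, neg_neg]

theorem exists_gaussian_map_euclidean {n : ℕ} (μ : Measure (EuclideanSpace ℝ (Fin n)))
    [IsProbabilityMeasure μ] (hμ : μ ≪ volume)
    (h2 : MemLp (fun z : EuclideanSpace ℝ (Fin n) => z) 2 μ) :
    ∃ S : EuclideanSpace ℝ (Fin n) → EuclideanSpace ℝ (Fin n), Measurable S ∧
      μ.map S = stdGaussian (EuclideanSpace ℝ (Fin n)) ∧
      ∃ a : Fin n → EuclideanSpace ℝ (Fin n) → ℝ, (∀ i, Measurable (a i)) ∧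
        (∀ᵐ z ∂μ, (∀ i, 0 < a i z) ∧
          (∏ i, a i z) * (μ.rnDeriv volume z).toReal = ∏ i, gaussianPDFReal 0 1 (S z i)) ∧
        ∀ i, ∫⁻ z, ENNReal.ofReal (a i z) ∂μ ≤ ENNReal.ofReal (∫ z, z i * S z i ∂μ) := by
  set e : EuclideanSpace ℝ (Fin n) ≃ᵐ (Fin n → ℝ) := (MeasurableEquiv.toLp 2 (Fin n → ℝ)).symm
  have he : MeasurePreserving e volume volume :=
    EuclideanSpace.volume_preserving_symm_measurableEquiv_toLp (Fin n)
  set f := μ.rnDeriv volume with hf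
  have hfm : Measurable f := Measure.measurable_rnDeriv μ volume
  have hmap : μ.map e = volume.withDensity (f ∘ e.symm) := by
    rw [← he.map_withDensity_equiv, hf, Measure.withDensity_rnDeriv_eq μ volume hμ]
  have hmp : MeasurePreserving e μ (volume.withDensity (f ∘ e.symm)) := ⟨e.measurable, hmap⟩
  have hP : IsProbabilityMeasure (volume.withDensity (f ∘ e.symm)) :=
    hmap ▸ Measure.isProbabilityMeasure_map e.measurable.aemeasurable
  have hcoord : ∀ i, MemLp (fun z : Fin n → ℝ => z i) 2 (volume.withDensity (f ∘ e.symm)) := by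
    intro i
    rw [← hmap, MeasurableEquiv.memLp_map_measure_iff]
    refine MemLp.of_le h2 (by fun_prop) (ae_of_all _ fun z => ?_)
    exact PiLp.norm_apply_le z i
  obtain ⟨S, hS, hSmap, a, ham, hae, hle⟩ := exists_triangular_gaussian_map n (f ∘ e.symm)
    (hfm.comp e.symm.measurable) hP hcoord
  refine ⟨fun z => e.symm (S (e z)), e.symm.measurable.comp (hS.comp e.measurable), ?_,
    fun i z => a i (e z), fun i => (ham i).comp e.measurable, ?_, fun i => ?_⟩
  · have h : (fun z => e.symm (S (e z))) = e.symm ∘ S ∘ e := rfl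
    rw [h, ← Measure.map_map e.symm.measurable (hS.comp e.measurable),
      ← Measure.map_map hS e.measurable, hmap, hSmap]
    exact (measurePreserving_toLp_gaussian n).map_eq
  · filter_upwards [hmp.quasiMeasurePreserving.ae hae] with z hz
    refine ⟨hz.1, ?_⟩
    have h := hz.2
    rw [Function.comp_apply, e.symm_apply_apply] at h
    exact h
  · rw [hmp.lintegral_comp (f := fun z => ENNReal.ofReal (a i z)) (ham i).ennreal_ofReal]
    refine (hle i).trans (le_of_eq ?_)
    rw [← hmp.integral_comp' (g := fun z : Fin n → ℝ => z i * S z i)]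
    rfl

/-- Jensen's inequality combined with the inequality between arithmetic and geometric means, in the
linearized form `log a ≤ a / b - 1 + log b` with `b` the mean of the bounds `c i`. The linearization
also shows that the positive part of `ℓ` is integrable without assuming this for `ℓ` itself. -/
theorem integral_sum_log_le {Ω : Type*} [MeasurableSpace Ω] {m : Measure Ω} [IsProbabilityMeasure m]
    {n : ℕ} (hn : 0 < n) {a : Fin n → Ω → ℝ} (ham : ∀ i, Measurable (a i)) {c : Fin n → ℝ}
    (hac : ∀ i, ∫⁻ x, ENNReal.ofReal (a i x) ∂m ≤ ENNReal.ofReal (c i))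
    {l G : Ω → ℝ} (hG : Integrable G m)
    (hae : ∀ᵐ x ∂m, (∀ i, 0 < a i x) ∧ l x = ∑ i, Real.log (a i x) + G x) :
    0 < ∑ i, c i ∧ ∫⁻ x, ENNReal.ofReal (l x) ∂m ≠ ∞ ∧
      (Integrable l m → ∫ x, l x ∂m ≤ n * Real.log ((∑ i, c i) / n) + ∫ x, G x ∂m) := by
  have hn' : (0 : ℝ) < n := by exact_mod_cast hn
  have hpos : ∀ i, ∀ᵐ x ∂m, 0 < a i x := fun i => hae.mono fun x hx => hx.1 i
  have hint : ∀ i, Integrable (a i) m := fun i => by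
    refine ⟨(ham i).aestronglyMeasurable, ?_⟩
    rw [hasFiniteIntegral_iff_ofReal ((hpos i).mono fun x hx => hx.le)]
    exact (hac i).trans_lt ENNReal.ofReal_lt_top
  have hipos : ∀ i, 0 < ∫ x, a i x ∂m := fun i => by
    rw [integral_pos_iff_support_of_nonneg_ae ((hpos i).mono fun x hx => hx.le) (hint i)]
    have h : m (Function.support (a i)) = m univ :=
      measure_congr ((hpos i).mono fun x hx => eq_true (show x ∈ Function.support (a i) from hx.ne')
        |>.trans (eq_true (mem_univ x)).symm)
    rw [h, measure_univ]
    exact one_pos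
  have hcpos : ∀ i, 0 < c i := fun i => by
    rw [← ENNReal.ofReal_pos]
    refine lt_of_lt_of_le ?_ (hac i)
    rw [← ofReal_integral_eq_lintegral_ofReal (hint i) ((hpos i).mono fun x hx => hx.le)]
    exact ENNReal.ofReal_pos.2 (hipos i)
  have hile : ∀ i, ∫ x, a i x ∂m ≤ c i := fun i => by
    rw [← ENNReal.ofReal_le_ofReal_iff (hcpos i).le,
      ofReal_integral_eq_lintegral_ofReal (hint i) ((hpos i).mono fun x hx => hx.le)]
    exact hac i
  have hne : (Finset.univ : Finset (Fin n)).Nonempty := ⟨⟨0, hn⟩, Finset.mem_univ _⟩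
  have hC : 0 < ∑ i, c i := Finset.sum_pos (fun i _ => hcpos i) hne
  set b := (∑ i, c i) / n with hb
  have hb0 : 0 < b := div_pos hC hn'
  have hlog : ∀ t, 0 < t → Real.log t ≤ t / b - 1 + Real.log b := fun t ht => by
    have h := Real.log_le_sub_one_of_pos (div_pos ht hb0)
    rw [Real.log_div ht.ne' hb0.ne'] at h
    linarith
  set L : Ω → ℝ := fun x => ∑ i, (a i x / b - 1 + Real.log b) + G x with hL
  have hsum : ∀ i, Integrable (fun x => a i x / b - 1 + Real.log b) m := fun i =>
    (((hint i).div_const b).sub (integrable_const _)).add (integrable_const _)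
  have hsum' : Integrable (fun x => ∑ i, (a i x / b - 1 + Real.log b)) m :=
    integrable_finsetSum _ fun i _ => hsum i
  have hLint : Integrable L m := hsum'.add hG
  have hlL : ∀ᵐ x ∂m, l x ≤ L x := by
    filter_upwards [hae] with x hx
    rw [hx.2]
    exact add_le_add_left (Finset.sum_le_sum fun i _ => hlog _ (hx.1 i)) _
  refine ⟨hC, ?_, fun hl => (integral_mono_ae hl hLint hlL).trans ?_⟩
  · refine ne_top_of_le_ne_top hLint.lintegral_lt_top.ne (lintegral_mono_ae ?_)
    filter_upwards [hlL] with x hx using ENNReal.ofReal_le_ofReal hx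
  · rw [hL, integral_add hsum' hG, integral_finsetSum _ fun i _ => hsum i]
    gcongr
    have h1 : ∀ i, ∫ x, (a i x / b - 1 + Real.log b) ∂m = (∫ x, a i x ∂m) / b - 1 + Real.log b := by
      intro i
      have h3 : Integrable (fun x => a i x / b - 1) m :=
        ((hint i).div_const b).sub (integrable_const _)
      rw [integral_add h3 (integrable_const _),
        integral_sub ((hint i).div_const b) (integrable_const _), integral_div]
      simp
    simp_rw [h1]
    rw [Finset.sum_add_distrib, Finset.sum_sub_distrib, ← Finset.sum_div]
    have h2 : (∑ i, ∫ x, a i x ∂m) / b ≤ n := by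
      rw [div_le_iff₀ hb0, hb, mul_div_cancel₀ _ hn'.ne']
      exact Finset.sum_le_sum fun i _ => hile i
    simp only [Finset.sum_const, Finset.card_univ, Fintype.card_fin, nsmul_eq_mul, mul_one]
    linarith

/-- Every law with a density and a second moment can be mapped to the standard Gaussian law so that
the correlation is at least `n` times the root of the normalized entropy power. -/
theorem exists_map_correlation_ge {n : ℕ} (hn : 0 < n) (μ : Measure (EuclideanSpace ℝ (Fin n)))
    [IsProbabilityMeasure μ] (hμ : μ ≪ volume)
    (h2 : MemLp (fun z : EuclideanSpace ℝ (Fin n) => z) 2 μ) :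
    ∃ S : EuclideanSpace ℝ (Fin n) → EuclideanSpace ℝ (Fin n), Measurable S ∧
      μ.map S = stdGaussian (EuclideanSpace ℝ (Fin n)) ∧ 0 ≤ ∫ z, inner ℝ z (S z) ∂μ ∧
      (InfoOT.differentialEntropy μ = ⊥ ∨ ∃ h : ℝ, InfoOT.differentialEntropy μ = h ∧
        1 / (2 * Real.pi * Real.exp 1) * Real.exp (2 / n * h) ≤
          ((∫ z, inner ℝ z (S z) ∂μ) / n) ^ 2) := by
  obtain ⟨S, hS, hSμ, a, ham, hae, hle⟩ := exists_gaussian_map_euclidean μ hμ h2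
  have hn' : (0 : ℝ) < n := by exact_mod_cast hn
  have hmp : MeasurePreserving S μ (stdGaussian (EuclideanSpace ℝ (Fin n))) := ⟨hS, hSμ⟩
  have hN : Integrable (fun z => ‖S z‖ ^ 2) μ :=
    ((memLp_normSq_stdGaussian n).comp_measurePreserving hmp).integrable (by norm_num)
  have hNint : ∫ z, ‖S z‖ ^ 2 ∂μ = n := by
    have h := integral_map (μ := μ) (f := fun y : EuclideanSpace ℝ (Fin n) => ‖y‖ ^ 2)
      hS.aemeasurable (by fun_prop)
    rw [hSμ, integral_normSq_stdGaussian] at h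
    exact h.symm
  have hSL : MemLp S 2 μ := (memLp_two_iff_integrable_sq_norm hS.aestronglyMeasurable).2 hN
  have hcoord : ∀ i, Integrable (fun z => z i * S z i) μ := fun i => by
    have h3 : MemLp (fun z : EuclideanSpace ℝ (Fin n) => z i) 2 μ :=
      MemLp.of_le h2 (by fun_prop) (ae_of_all _ fun z => PiLp.norm_apply_le z i)
    have h4 : MemLp (fun z : EuclideanSpace ℝ (Fin n) => S z i) 2 μ :=
      MemLp.of_le hSL (by fun_prop) (ae_of_all _ fun z => PiLp.norm_apply_le (S z) i)
    exact h3.integrable_mul h4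
  have hinner : ∑ i, ∫ z, z i * S z i ∂μ = ∫ z, inner ℝ z (S z) ∂μ := by
    rw [← integral_finsetSum _ fun i _ => hcoord i]
    refine integral_congr_ae (ae_of_all _ fun z => ?_)
    simp [PiLp.inner_apply, mul_comm]
  set f := μ.rnDeriv volume with hf
  set G : EuclideanSpace ℝ (Fin n) → ℝ := fun z =>
    n * Real.log (2 * Real.pi) / 2 + ‖S z‖ ^ 2 / 2 with hGdef
  have hG : Integrable G μ := (integrable_const _).add (hN.div_const 2)
  have hGint : ∫ z, G z ∂μ = n * Real.log (2 * Real.pi * Real.exp 1) / 2 := by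
    rw [hGdef, integral_add (integrable_const _) (hN.div_const 2),
      integral_div (2 : ℝ) fun z => ‖S z‖ ^ 2, hNint,
      Real.log_mul (by positivity) (Real.exp_ne_zero _), Real.log_exp]
    simp
    ring
  have hlogφ : ∀ t, Real.log (gaussianPDFReal 0 1 t) = -(Real.log (2 * Real.pi) / 2) - t ^ 2 / 2 := by
    intro t
    rw [gaussianPDFReal, Real.log_mul (by positivity) (Real.exp_ne_zero _), Real.log_exp,
      Real.log_inv, Real.log_sqrt (by positivity)]
    simp
    ring
  have hae' : ∀ᵐ z ∂μ, (∀ i, 0 < a i z) ∧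
      -Real.log (f z).toReal = ∑ i, Real.log (a i z) + G z := by
    filter_upwards [hae] with z hz
    refine ⟨hz.1, ?_⟩
    have hprod : 0 < ∏ i, gaussianPDFReal 0 1 (S z i) :=
      Finset.prod_pos fun i _ => gaussianPDFReal_pos 0 1 _ one_ne_zero
    have hf0 : (f z).toReal ≠ 0 := fun h => by
      rw [h, mul_zero] at hz
      exact hprod.ne hz.2
    have h := congrArg Real.log hz.2
    rw [Real.log_mul (Finset.prod_pos fun i _ => hz.1 i).ne' hf0,
      Real.log_prod fun i _ => (hz.1 i).ne',
      Real.log_prod fun i _ => (gaussianPDFReal_pos 0 1 _ one_ne_zero).ne'] at h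
    simp_rw [hlogφ] at h
    rw [Finset.sum_sub_distrib, ← Finset.sum_div, ← EuclideanSpace.real_norm_sq_eq] at h
    simp only [Finset.sum_const, Finset.card_univ, Fintype.card_fin, nsmul_eq_mul] at h
    simp only [hGdef]
    linarith
  obtain ⟨hC, htop, hbound⟩ := integral_sum_log_le hn ham hle hG hae'
  rw [hinner] at hC hbound
  refine ⟨S, hS, hSμ, hC.le, ?_⟩
  rw [differentialEntropy_eq μ hμ]
  by_cases hneg : ∫⁻ x, ENNReal.ofReal (Real.log (f x).toReal) ∂μ = ∞
  · left
    rw [hneg]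
    exact EReal.sub_top _
  · right
    have hfm : Measurable f := Measure.measurable_rnDeriv μ volume
    have hl : Integrable (fun z => -Real.log (f z).toReal) μ := by
      refine ⟨hfm.ennreal_toReal.log.neg.aestronglyMeasurable, ?_⟩
      rw [hasFiniteIntegral_iff_norm]
      have h : ∀ z, ENNReal.ofReal ‖-Real.log (f z).toReal‖ =
          ENNReal.ofReal (-Real.log (f z).toReal) + ENNReal.ofReal (Real.log (f z).toReal) := by
        intro z
        rcases le_total 0 (Real.log (f z).toReal) with h | h
        · simp [abs_of_nonneg h, ENNReal.ofReal_of_nonpos (neg_nonpos.2 h)]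
        · simp [abs_of_nonpos h, ENNReal.ofReal_of_nonpos h]
      simp_rw [h]
      rw [lintegral_add_left (by fun_prop)]
      exact ENNReal.add_lt_top.2 ⟨htop.lt_top, lt_top_iff_ne_top.2 hneg⟩
    refine ⟨∫ z, -Real.log (f z).toReal ∂μ, ?_, ?_⟩
    · rw [integral_eq_lintegral_pos_part_sub_lintegral_neg_part hl]
      simp only [neg_neg]
      rw [EReal.coe_sub, EReal.coe_ennreal_toReal htop, EReal.coe_ennreal_toReal hneg]
    · have h := hbound hl
      rw [hGint] at h
      set c := ∫ z, inner ℝ z (S z) ∂μ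
      set H := ∫ z, -Real.log (f z).toReal ∂μ
      have hcn : 0 < c / n := div_pos hC hn'
      have h3 : 2 / n * H ≤ Real.log ((c / n) ^ 2 * (2 * Real.pi * Real.exp 1)) := by
        rw [Real.log_mul (by positivity) (by positivity), Real.log_pow]
        have : 2 / (n : ℝ) * H ≤ 2 / n * (n * Real.log (c / n) +
          n * Real.log (2 * Real.pi * Real.exp 1) / 2) := by gcongr
        refine this.trans (le_of_eq ?_)
        field_simp
        push_cast
        ring
      rw [Real.le_log_iff_exp_le (by positivity)] at h3
      rw [one_div, inv_mul_le_iff₀ (by positivity)]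
      linarith

end

/-! ### The bound for the constrained transport cost -/

theorem theoremP (n : ℕ) (hn : 0 < n)
    (μ : Measure (EuclideanSpace ℝ (Fin n))) [IsProbabilityMeasure μ]
    (hμ₂ : Integrable (fun z => ‖z‖ ^ 2) μ)
    (hμ : μ ≪ stdGaussian (EuclideanSpace ℝ (Fin n)))
    (R τ : ℝ≥0) :
    ((InfoOT.infoDensityWasserstein 2 μ (stdGaussian (EuclideanSpace ℝ (Fin n)))
        R τ (6 * (n : ℝ≥0∞) / (τ : ℝ≥0∞) ^ 2) ^ 2 : ℝ≥0∞) : EReal) ≤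
      ((∫ z, ‖z‖ ^ 2 ∂μ : ℝ) : EReal) + ((n : ℝ) : EReal) -
        ((2 * (n : ℝ) : ℝ) : EReal) *
          (((ENNReal.ofReal (1 / (2 * Real.pi * Real.exp 1)) *
              EReal.exp (((2 / (n : ℝ) : ℝ) : EReal) * InfoOT.differentialEntropy μ) *
              ENNReal.ofReal (1 - Real.exp (-(2 * (R : ℝ) / (n : ℝ))))) ^ (1 / 2 : ℝ) : ℝ≥0∞) :
            EReal) := by
  have hn' : (0 : ℝ) < n := by exact_mod_cast hn
  have hvol : μ ≪ volume := hμ.trans (stdGaussian_absolutelyContinuous n)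
  have h2 : MemLp (fun z : EuclideanSpace ℝ (Fin n) => z) 2 μ :=
    (memLp_two_iff_integrable_sq_norm aestronglyMeasurable_id).2 hμ₂
  obtain ⟨S, hS, hSμ, hc0, hent⟩ := exists_map_correlation_ge hn μ hvol h2
  set c := ∫ z, inner ℝ z (S z) ∂μ with hc
  set q : ℝ := 1 - Real.exp (-(2 * (R : ℝ) / (n : ℝ))) with hq
  have hq0 : 0 ≤ q := by
    rw [hq, sub_nonneg, Real.exp_le_one_iff]
    have : 0 ≤ 2 * (R : ℝ) / n := by positivity
    linarith
  set s := Real.exp (-((R : ℝ) / n)) with hs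
  have hrs : √q ^ 2 + s ^ 2 = 1 := by
    rw [Real.sq_sqrt hq0, hs, ← Real.exp_nat_mul, hq]
    have : ((2 : ℕ) : ℝ) * -((R : ℝ) / n) = -(2 * (R : ℝ) / n) := by push_cast; ring
    rw [this]
    ring
  obtain ⟨hcost, hval⟩ := lintegral_edist_gaussCoupling hS hSμ hrs hμ₂
  -- the coupling is admissible and has the computed cost
  have hW : InfoOT.infoDensityWasserstein 2 μ (stdGaussian (EuclideanSpace ℝ (Fin n)))
      R τ (6 * (n : ℝ≥0∞) / (τ : ℝ≥0∞) ^ 2) ^ 2 ≤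
        ENNReal.ofReal (∫ z, ‖z‖ ^ 2 ∂μ + n - 2 * √q * c) := by
    rw [hc, ← hval]
    have h : InfoOT.infoDensityWasserstein 2 μ (stdGaussian (EuclideanSpace ℝ (Fin n)))
        R τ (6 * (n : ℝ≥0∞) / (τ : ℝ≥0∞) ^ 2) ≤
          (∫⁻ w, edist w.1 w.2 ^ (2 : ℝ) ∂(gaussCoupling μ S (√q) s)) ^ (1 / 2 : ℝ) :=
      iInf₂_le _ ⟨⟨fst_gaussCoupling hS, snd_gaussCoupling hS hSμ hrs⟩,
        infoDensityConstraint_gaussCoupling hS hSμ hrs hn hs τ⟩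
    refine (pow_le_pow_left' h 2).trans (le_of_eq ?_)
    rw [← ENNReal.rpow_natCast, ← ENNReal.rpow_mul]
    norm_num
  have hW' : ((InfoOT.infoDensityWasserstein 2 μ (stdGaussian (EuclideanSpace ℝ (Fin n)))
      R τ (6 * (n : ℝ≥0∞) / (τ : ℝ≥0∞) ^ 2) ^ 2 : ℝ≥0∞) : EReal) ≤
        ((∫ z, ‖z‖ ^ 2 ∂μ + n - 2 * √q * c : ℝ) : EReal) := by
    refine (EReal.coe_ennreal_le_coe_ennreal_iff.2 hW).trans (le_of_eq ?_)
    rw [EReal.coe_ennreal_ofReal, max_eq_left hcost]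
  refine hW'.trans ?_
  -- the entropy power is a real number, equal to `0` when the entropy is `-∞`
  obtain ⟨N, hN0, hN, hNc⟩ : ∃ N : ℝ, 0 ≤ N ∧ ENNReal.ofReal (1 / (2 * Real.pi * Real.exp 1)) *
      EReal.exp (((2 / (n : ℝ) : ℝ) : EReal) * InfoOT.differentialEntropy μ) = ENNReal.ofReal N ∧
      N ≤ (c / n) ^ 2 := by
    rcases hent with h | ⟨h, hh, hle⟩
    · refine ⟨0, le_rfl, ?_, by positivity⟩
      rw [h, EReal.coe_mul_bot_of_pos (by positivity)]
      simp
    · refine ⟨_, by positivity, ?_, hle⟩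
      rw [hh, ← EReal.coe_mul, EReal.exp_coe, ← ENNReal.ofReal_mul (by positivity)]
  rw [hN, ← ENNReal.ofReal_mul hN0, ENNReal.ofReal_rpow_of_nonneg (by positivity) (by norm_num),
    EReal.coe_ennreal_ofReal, max_eq_left (by positivity), ← Real.sqrt_eq_rpow, ← EReal.coe_mul,
    ← EReal.coe_add, ← EReal.coe_sub, EReal.coe_le_coe_iff, Real.sqrt_mul hN0]
  have h1 : √N ≤ c / n := Real.sqrt_le_iff.2 ⟨by positivity, hNc⟩
  have h3 : n * √N ≤ c := by
    rw [le_div_iff₀ hn'] at h1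
    linarith
  have h4 := mul_le_mul_of_nonneg_right h3 (Real.sqrt_nonneg q)
  linarith
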